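/- Let $\kappa$ be an algebraically closed field of characteristic $p>3$, and let $\mathfrak g=\mathfrak g_0\oplus\mathfrak g_1$ be a finite-dimensional Lie superalgebra over $\kappa$ with universal enveloping algebra $U(\mathfrak g)$. Let $x_1,\dots,x_s$ be a basis of $\mathfrak g_1$ such that, for some $0\le s_1\le s$, $[x_i,x_i]=0$ for $i\le s_1$ and $z_j:=[x_j,x_j]\neq 0$ for $s_1<j\le s$. Assume that $z_{s_1+1},\dots,z_s$ are linearly independent and let $V\subseteq\mathfrak g_0$ be the subspace spanned by them. Let $W$ be a subspace of $\mathfrak g_0$ with $\mathfrak g_0=W\oplus V$, and let $y_1,\dots,y_{t_1}$ be a basis of $W$. Then: (1) $U(\mathfrak g)$ has a $\kappa$-basis consisting of the elements $$x_1^{a_1}\cdots x_{s_1}^{a_{s_1}}\,x_{s_1+1}^{b_1}\cdots x_s^{b_{s-s_1}}\,y_1^{c_1}\cdots y_{t_1}^{c_{t_1}},\qquad 0\le a_i<2,\quad b_j,c_k\in\mathbb N=\{0,1,2,\dots\}.$$ (2) If $\mathfrak g$ is restricted with $p$-th power map $x\mapsto x^{[p]}$ on $\mathfrak g_0$, then its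 restricted enveloping algebra $\mathbf u(\mathfrak g)=U(\mathfrak g)/(x^p-x^{[p]}\mid x\in\mathfrak g_0)$ has a $\kappa$-basis consisting of the elements $$x_1^{a_1}\cdots x_{s_1}^{a_{s_1}}\,x_{s_1+1}^{b_1}\cdots x_s^{b_{s-s_1}}\,y_1^{c_1}\cdots y_{t_1}^{c_{t_1}},\qquad 0\le a_i<2,\quad 0\le b_j<2p,\quad 0\le c_k<p.$$ Here $\mathfrak g$ is called restricted if there is a map $\mathfrak g_0\to\mathfrak g_0$, $x\mapsto x^{[p]}$, such that $(cx)^{[p]}=c^px^{[p]}$ for $c\in\kappa$, $x\in\mathfrak g_0$; $[x^{[p]},y]=(\operatorname{ad}x)^p(y)$ for $x\in\mathfrak g_0$, $y\in\mathfrak g$; and $(x+y)^{[p]}=x^{[p]}+y^{[p]}+\sum_{i=1}^{p-1}s_i(x,y)$ for $x,y\in\mathfrak g_0$, where $i\,s_i(x,y)$ is the coefficient of $\lambda^{i-1}$ in $(\operatorname{ad}(\lambda x+y))^{p-1}(x)$. -/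

import Mathlib

universe u v

/-- A Lie superalgebra over a field `κ` (to be used in characteristic different from `2` and `3`)
with underlying vector space `g`: a `ℤ/2`-grading `g = g₀ ⊕ g₁` and an even bilinear bracket that
is super skew-symmetric and satisfies the super Jacobi identity. -/
structure LieSuperalgebra (κ : Type u) (g : Type v) [Field κ] [AddCommGroup g] [Module κ g] where
  /-- the homogeneous components; `grade 0` is the even part, `grade 1` the odd part -/
  grade : ZMod 2 → Submodule κ g
  isInternal : DirectSum.IsInternal grade
  /-- the superbracket -/
  bracket : g →ₗ[κ] g →ₗ[κ] g
  bracket_mem : ∀ (i j : ZMod 2) (a b : g), a ∈ grade i → b ∈ grade j →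
    bracket a b ∈ grade (i + j)
  skew : ∀ (i j : ZMod 2) (a b : g), a ∈ grade i → b ∈ grade j →
    bracket a b = -((-1 : κ) ^ (i.val * j.val) • bracket b a)
  jacobi : ∀ (i j : ZMod 2) (a b c : g), a ∈ grade i → b ∈ grade j →
    bracket a (bracket b c) =
      bracket (bracket a b) c + (-1 : κ) ^ (i.val * j.val) • bracket b (bracket a c)

namespace LieSuperalgebra

section

variable {κ : Type u} {g : Type v} [Field κ] [AddCommGroup g] [Module κ g]
variable (L : LieSuperalgebra κ g)

/-- The adjoint map `b ↦ [a, b]` on all of `g`. -/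
def ad (a : g) : Module.End κ g := L.bracket a

/-- `s_i(a, b)`: the element such that `i s_i(a, b)` is the coefficient of `λ ^ (i - 1)` in
`(ad (λ a + b)) ^ (p - 1) (a)`. The power is computed in polynomials in `λ` with coefficients in
`End g`. Only used for `1 ≤ i ≤ p - 1` in characteristic `p`, where `i` is invertible in `κ`. -/
noncomputable def jacobsonTerm (p i : ℕ) (a b : g) : g :=
  (i : κ)⁻¹ •
    (((Polynomial.X * Polynomial.C (L.ad a) + Polynomial.C (L.ad b)) ^ (p - 1)).coeff (i - 1)) a

/-- `pm` is a `p`-th power map `a ↦ a^[p]` on the even part, making `g` a restricted Lie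
superalgebra. -/
structure IsPMap (p : ℕ) (pm : L.grade 0 → L.grade 0) : Prop where
  smul : ∀ (c : κ) (a : L.grade 0), pm (c • a) = c ^ p • pm a
  ad_pow : ∀ (a : L.grade 0) (b : g), L.bracket (pm a : g) b = (L.ad (a : g) ^ p) b
  add : ∀ a b : L.grade 0, (pm (a + b) : g) =
    (pm a : g) + (pm b : g) + ∑ i ∈ Finset.Icc 1 (p - 1), L.jacobsonTerm p i (a : g) (b : g)

/-- The defining relations `a ⊗ b = [a, b] + (-1)^{|a||b|} b ⊗ a`, for homogeneous `a`, `b`, of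
the universal enveloping algebra. -/
inductive URel : TensorAlgebra κ g → TensorAlgebra κ g → Prop
  | mk (i j : ZMod 2) (a b : g) (ha : a ∈ L.grade i) (hb : b ∈ L.grade j) :
      URel (TensorAlgebra.ι κ a * TensorAlgebra.ι κ b)
        (TensorAlgebra.ι κ (L.bracket a b) +
          (-1 : κ) ^ (i.val * j.val) • (TensorAlgebra.ι κ b * TensorAlgebra.ι κ a))

/-- The universal enveloping algebra `U(g)`, as an associative algebra. -/
abbrev UEnv : Type (max u v) := RingQuot L.URel

/-- The canonical map `g → U(g)`. -/
noncomputable def ιU : g →ₗ[κ] L.UEnv :=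
  (RingQuot.mkAlgHom κ L.URel).toLinearMap ∘ₗ TensorAlgebra.ι κ

/-- The relations `a ^ p = a^[p]`, for even `a`, that cut the restricted enveloping algebra out of
`U(g)`. -/
inductive RRel (p : ℕ) (pm : L.grade 0 → L.grade 0) : L.UEnv → L.UEnv → Prop
  | mk (a : L.grade 0) : RRel p pm (L.ιU (a : g) ^ p) (L.ιU (pm a : g))

/-- The restricted enveloping algebra `u(g) = U(g) / (a ^ p - a^[p] | a ∈ g₀)`. -/
abbrev REnv (p : ℕ) (pm : L.grade 0 → L.grade 0) : Type (max u v) := RingQuot (L.RRel p pm)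

/-- The canonical map `g → u(g)`. -/
noncomputable def ιR (p : ℕ) (pm : L.grade 0 → L.grade 0) : g →ₗ[κ] L.REnv p pm :=
  (RingQuot.mkAlgHom κ (L.RRel p pm)).toLinearMap ∘ₗ L.ιU

end

end LieSuperalgebra

/-- The ordered monomial `x₁ ^ e₁ ⋯ x_n ^ e_n` in a monoid. -/
def orderedMonomial {A : Type*} [Monoid A] {n : ℕ} (x : Fin n → A) (e : Fin n → ℕ) : A :=
  (List.ofFn fun i => x i ^ e i).prod

/-
The defining relations of `U(g)` rewrite words in a homogeneous basis of `g`, and their overlaps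
resolve by the Jacobi identity, so by the diamond lemma the ordered monomials form a basis. For even
`a` the element `a ^ p - a^[p]` of `U(g)` is central and `p`-semilinear in `a`. Since `a ^ p` is its
leading term, the factors `a ^ c` of the ordered monomials can be replaced by
`a ^ (c % p) * (a ^ p - a^[p]) ^ (c / p)`, and in the basis so obtained the kernel of `U(g) → u(g)`
is spanned by the monomials with some `c ≥ p`. Finally, `x_j ^ 2 = [x_j, x_j] / 2` for odd `x_j`, so
in a basis of `g` that contains these squares each pair of factors `x_j ^ a * (x_j ^ 2) ^ b` with
`a < 2` merges into a single power of `x_j`.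
-/

section LinearAlgebra

open Submodule

variable {R M N X : Type*} [Ring R] [AddCommGroup M] [Module R M] [AddCommGroup N] [Module R N]

theorem exists_basis_of_ker_eq_span_image_compl (b : Module.Basis X R M) {f : M →ₗ[R] N}
    (hf : Function.Surjective f) {S : Set X} (hker : LinearMap.ker f = span R (b '' Sᶜ)) :
    ∃ B : Module.Basis S R N, ∀ i, B i = f (b i) := by
  have hrange : Set.range (fun i : S => b i) = b '' S := by
    rw [Set.image_eq_range]
  have hli : LinearIndependent R (f ∘ fun i : S => b i) := by
    refine (b.linearIndependent.comp _ Subtype.val_injective).map ?_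
    rw [hker]
    change Disjoint (span R (Set.range fun i : S => b i)) _
    rw [hrange]
    exact b.linearIndependent.disjoint_span_image disjoint_compl_right
  have hspan : ⊤ ≤ span R (Set.range (f ∘ fun i : S => b i)) := by
    rw [Set.range_comp, hrange, ← map_span, ← LinearMap.range_eq_top.2 hf,
      LinearMap.range_eq_map, LinearMap.map_le_map_iff, hker, ← span_union, ← Set.image_union,
      Set.union_compl_self, Set.image_univ, b.span_eq]
  exact ⟨Module.Basis.mk hli hspan, fun i => by simp⟩

variable (r : X → X → Prop) [IsWellFounded X r] {b : Module.Basis X R M} {v : X → M}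

theorem linearIndependent_of_triangular
    (hv : ∀ i, v i - b i ∈ span R (b '' {j | r j i})) : LinearIndependent R v := by
  refine linearIndependent_iff.2 fun c hc => by_contra fun hne => ?_
  obtain ⟨i, hi, hmax⟩ := c.support.exists_maximalFor (IsWellFounded.rank r)
    (Finsupp.support_nonempty_iff.2 hne)
  have hcoeff : ∀ j ∈ c.support, b.repr (v j) i = b.repr (b j) i := fun j hj => by
    have hsupp := b.mem_span_image.1 (hv j)
    rw [← sub_eq_zero, ← Finsupp.sub_apply, ← map_sub]
    by_contra h
    have hij := IsWellFounded.rank_lt_of_rel (r := r) (hsupp (Finsupp.mem_support_iff.2 h))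
    exact hij.not_ge (hmax hj hij.le)
  have hsum : ∑ j ∈ c.support, c j * b.repr (v j) i = 0 := by
    simpa [Finsupp.linearCombination_apply, Finsupp.sum] using
      congrArg (fun m => b.repr m i) hc
  rw [Finset.sum_congr rfl fun j hj => by rw [hcoeff j hj]] at hsum
  refine Finsupp.mem_support_iff.1 hi ?_
  classical
  simpa [Finsupp.single_apply, Finset.sum_ite_eq', hi] using hsum

theorem span_range_eq_top_of_triangular
    (hv : ∀ i, v i - b i ∈ span R (b '' {j | r j i})) : span R (Set.range v) = ⊤ := by
  have hb : ∀ i, b i ∈ span R (Set.range v) := fun i => by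
    induction i using IsWellFounded.induction r with
    | _ i ih =>
      have hlow : span R (b '' {j | r j i}) ≤ span R (Set.range v) := by
        rw [span_le, Set.image_subset_iff]
        exact ih
      have hvi : v i ∈ span R (Set.range v) := subset_span (Set.mem_range_self i)
      exact (sub_mem_iff_right _ hvi).1 (hlow (hv i))
  rw [eq_top_iff, ← b.span_eq, span_le]
  exact Set.range_subset_iff.2 hb

theorem exists_basis_of_triangular
    (hv : ∀ i, v i - b i ∈ span R (b '' {j | r j i})) :
    ∃ B : Module.Basis X R M, ∀ i, B i = v i :=
  ⟨Module.Basis.mk (linearIndependent_of_triangular r hv)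
    (span_range_eq_top_of_triangular r hv).ge, fun i => Module.Basis.mk_apply _ _ i⟩

variable {P : X → Set M} (hlead : ∀ w, ∀ m ∈ P w, m - b w ∈ span R (b '' {v | r v w}))
include hlead

theorem exists_basis_of_confluent
    (hconf : ∀ w, ∀ m ∈ P w, ∀ m' ∈ P w, m - m' ∈ span R (⋃ v ∈ {v | r v w}, P v))
    {f : M →ₗ[R] N} (hf : Function.Surjective f) (hker : LinearMap.ker f = span R (⋃ w, P w)) :
    ∃ B : Module.Basis {w // P w = ∅} R N, ∀ w, B w = f (b w) := by
  classical
  let v (w : X) : M := if h : (P w).Nonempty then h.some else b w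
  have hv_pos {w} (h : (P w).Nonempty) : v w = h.some := dif_pos h
  have hv_neg {w} (h : P w = ∅) : v w = b w := dif_neg (Set.not_nonempty_iff_eq_empty.2 h)
  obtain ⟨C, hC⟩ := exists_basis_of_triangular r (v := v) (b := b) fun w => by
    rcases (P w).eq_empty_or_nonempty with h | h
    · simp only [hv_neg h, sub_self, zero_mem]
    · simpa only [hv_pos h] using hlead w _ h.some_mem
  have hker' : LinearMap.ker f = span R (C '' {w | P w = ∅}ᶜ) := by
    refine hker.trans (le_antisymm (span_le.2 (Set.iUnion_subset fun w => ?_)) (span_mono ?_))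
    · induction w using IsWellFounded.induction r with
      | _ w ih =>
        intro m hm
        have hne : (P w).Nonempty := ⟨m, hm⟩
        have hCw : C w ∈ span R (C '' {w | P w = ∅}ᶜ) :=
          subset_span ⟨w, hne.ne_empty, rfl⟩
        rw [hC, hv_pos hne] at hCw
        have hlow : span R (⋃ v ∈ {v | r v w}, P v) ≤ span R (C '' {w | P w = ∅}ᶜ) :=
          span_le.2 (Set.iUnion₂_subset ih)
        exact (sub_mem_iff_left _ hCw).1 (hlow (hconf w m hm _ hne.some_mem))
    · rintro _ ⟨w, hw, rfl⟩
      have hne : (P w).Nonempty := Set.nonempty_iff_ne_empty.2 hw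
      rw [hC, hv_pos hne]
      exact Set.mem_iUnion_of_mem w hne.some_mem
  obtain ⟨B, hB⟩ := exists_basis_of_ker_eq_span_image_compl C hf hker'
  exact ⟨B, fun w => by rw [hB, hC, hv_neg w.2]⟩

theorem mem_span_irreducible {D : Type*} [Preorder D] {deg : X → D}
    (hdeg : ∀ ⦃v w⦄, r v w → deg v ≤ deg w) {f : M →ₗ[R] N}
    (hP : ∀ w, ∀ m ∈ P w, f m = 0) (w : X) :
    f (b w) ∈ span R ((fun v => f (b v)) '' {v | P v = ∅ ∧ deg v ≤ deg w}) := by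
  induction w using IsWellFounded.induction r with
  | _ w ih =>
    rcases (P w).eq_empty_or_nonempty with h | ⟨m, hm⟩
    · exact subset_span ⟨w, ⟨h, le_rfl⟩, rfl⟩
    · have hlow : span R (b '' {v | r v w}) ≤
          (span R ((fun v => f (b v)) '' {v | P v = ∅ ∧ deg v ≤ deg w})).comap f := by
        rw [span_le, Set.image_subset_iff]
        exact fun v hv => span_mono (Set.image_mono (Set.ofPred_subset_ofPred.2
          fun u hu => ⟨hu.1, hu.2.trans (hdeg hv)⟩)) (ih v hv)
      simpa only [mem_comap, map_sub, hP w m hm, zero_sub, neg_mem_iff] using hlow (hlead w m hm)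

end LinearAlgebra

theorem mul_mul_mem_of_mem_span {κ A : Type*} [CommSemiring κ] [Semiring A] [Algebra κ A]
    {S : Set A} {N : Submodule κ A} {a b t : A} (ht : t ∈ Submodule.span κ S)
    (h : ∀ s ∈ S, a * s * b ∈ N) : a * t * b ∈ N :=
  (Submodule.span_le (p := N.comap (LinearMap.mulRight κ b ∘ₗ LinearMap.mulLeft κ a))).2 h ht

theorem ker_ringQuot_mkAlgHom {κ A : Type*} [CommRing κ] [Ring A] [Algebra κ A]
    (r : A → A → Prop) :
    LinearMap.ker (RingQuot.mkAlgHom κ r).toLinearMap =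
      ⊤ * Submodule.span κ {m | ∃ a b, r a b ∧ m = a - b} * ⊤ := by
  set J : Submodule κ A := ⊤ * Submodule.span κ {m | ∃ a b, r a b ∧ m = a - b} * ⊤
  refine le_antisymm (fun u hu => ?_) ?_
  · -- The largest ring congruence whose zero class lies in `J` identifies related elements.
    let C : RingCon A :=
      { r a b := ∀ c d, c * (a - b) * d ∈ J
        iseqv := ⟨fun a c d => by simp,
          fun h c d => by simpa [mul_sub, sub_mul] using J.neg_mem (h c d),
          fun h h' c d => by simpa [← mul_add, ← add_mul] using J.add_mem (h c d) (h' c d)⟩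
        mul' := fun {a a' b b'} h h' c d => by
          convert J.add_mem (h c (b * d)) (h' (c * a') d) using 1
          noncomm_ring
        add' := fun {a a' b b'} h h' c d => by
          convert J.add_mem (h c d) (h' c d) using 1
          noncomm_ring }
    have hrel : ∀ ⦃a b⦄, r a b → C.mk' a = C.mk' b := fun a b hab => C.eq.2 fun c d =>
      Submodule.mul_mem_mul (Submodule.mul_mem_mul Submodule.mem_top
        (Submodule.subset_span ⟨a, b, hab, rfl⟩)) Submodule.mem_top
    have hu' : RingQuot.mkRingHom r u = 0 := by
      rw [← RingQuot.mkAlgHom_coe κ]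
      exact hu
    have hC : C.mk' u = C.mk' 0 := by
      rw [← RingQuot.lift_mkRingHom_apply C.mk' hrel, hu', map_zero, map_zero]
    simpa using C.eq.1 hC 1 1
  · have hspan : Submodule.span κ {m | ∃ a b, r a b ∧ m = a - b} ≤
        LinearMap.ker (RingQuot.mkAlgHom κ r).toLinearMap := by
      rw [Submodule.span_le]
      rintro _ ⟨a, b, hab, rfl⟩
      simp [RingQuot.mkAlgHom_rel κ hab]
    have hmul : ⊤ * Submodule.span κ {m | ∃ a b, r a b ∧ m = a - b} ≤
        LinearMap.ker (RingQuot.mkAlgHom κ r).toLinearMap :=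
      Submodule.mul_le.2 fun c _ t ht => by
        have ht' : RingQuot.mkAlgHom κ r t = 0 := hspan ht
        simp [ht']
    refine Submodule.mul_le.2 fun m hm d _ => ?_
    have hm' : RingQuot.mkAlgHom κ r m = 0 := hmul hm
    simp [hm']

section Words

variable {ι : Type*} {r : ι → ι → Prop}

theorem lex_append_of_length_eq {s t : List ι} (hl : s.length = t.length) (h : List.Lex r s t)
    (u : List ι) : List.Lex r (s ++ u) (t ++ u) := by
  induction h with
  | nil => simp at hl
  | cons _ ih => exact List.Lex.cons (ih (by simpa using hl))
  | rel h => exact List.Lex.rel h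

theorem shortlex_append_append {s t : List ι} (h : List.Shortlex r s t) (u v : List ι) :
    List.Shortlex r (u ++ s ++ v) (u ++ t ++ v) := by
  rw [List.append_assoc, List.append_assoc]
  refine List.Shortlex.append_left ?_ u
  rcases List.shortlex_def.1 h with h | ⟨h, h'⟩
  · exact List.Shortlex.of_length_lt (by simpa using h)
  · exact List.Shortlex.of_lex (by simpa using h) (lex_append_of_length_eq h h' v)

end Words

section QuadraticRelations

open List

variable {κ M N ι : Type*} [CommRing κ] [AddCommGroup M] [Module κ M] [AddCommGroup N] [Module κ N]
  (e : Module.Basis ι κ M)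

/-- The product, in the tensor algebra, of the basis vectors of a word. -/
noncomputable def word (w : List ι) : TensorAlgebra κ M :=
  (w.map fun i => TensorAlgebra.ι κ (e i)).prod

theorem word_append (v w : List ι) : word e (v ++ w) = word e v * word e w := by
  simp only [word, map_append, prod_append]

theorem word_cons (i : ι) (w : List ι) :
    word e (i :: w) = TensorAlgebra.ι κ (e i) * word e w := by
  simp only [word, map_cons, prod_cons]

theorem word_nil : word e [] = 1 := rfl

theorem basisFreeMonoid_eq_prod (w : List ι) :
    FreeAlgebra.basisFreeMonoid κ ι (FreeMonoid.ofList w) = (w.map (FreeAlgebra.ι κ)).prod := by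
  have hw : FreeAlgebra.equivMonoidAlgebraFreeMonoid (R := κ) (w.map (FreeAlgebra.ι κ)).prod =
      MonoidAlgebra.of κ (FreeMonoid ι) (FreeMonoid.ofList w) := by
    induction w with
    | nil => simp [MonoidAlgebra.one_def]
    | cons i w ih =>
      rw [List.map_cons, List.prod_cons, map_mul, ih, FreeMonoid.ofList_cons, map_mul]
      congr 1
      exact FreeAlgebra.lift_ι_apply _ _
  rw [FreeAlgebra.basisFreeMonoid, Module.Basis.map_apply, LinearEquiv.symm_apply_eq]
  simpa using congrArg MonoidAlgebra.coeff hw.symm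

theorem exists_wordBasis :
    ∃ b : Module.Basis (List ι) κ (TensorAlgebra κ M), ⇑b = word e := by
  refine ⟨e.tensorAlgebra.reindex FreeMonoid.toList, funext fun w => ?_⟩
  rw [Module.Basis.reindex_apply]
  change (TensorAlgebra.equivFreeAlgebra e).symm
    (FreeAlgebra.basisFreeMonoid κ ι (FreeMonoid.ofList w)) = _
  rw [basisFreeMonoid_eq_prod, map_list_prod, List.map_map, word]
  simp only [Function.comp_def, TensorAlgebra.equivFreeAlgebra_symm_ι]

theorem span_range_word : Submodule.span κ (Set.range (word e)) = ⊤ := by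
  obtain ⟨b, hb⟩ := exists_wordBasis e
  rw [← b.span_eq, hb]

variable (red : ι → ι → Prop) (ρ : ι → ι → TensorAlgebra κ M)

/-- The multiples by words of the quadratic relations `ρ i j`, for `red i j`, which have the word
`w` as leading term when each `ρ i j` has leading term `e i ⊗ e j`. -/
def wordRels (w : List ι) : Set (TensorAlgebra κ M) :=
  {m | ∃ A B i j, w = A ++ i :: j :: B ∧ red i j ∧ m = word e A * ρ i j * word e B}

/-- The span of the multiples of quadratic relations that have their leading term in `S`. -/
def relSpan (S : Set (List ι)) : Submodule κ (TensorAlgebra κ M) :=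
  Submodule.span κ (⋃ w ∈ S, wordRels e red ρ w)

variable {e red ρ}

theorem word_mul_mul_word_mem_relSpan {S : Set (List ι)} {A B : List ι} {i j : ι} (h : red i j)
    (hS : A ++ i :: j :: B ∈ S) : word e A * ρ i j * word e B ∈ relSpan e red ρ S :=
  Submodule.subset_span (Set.mem_biUnion hS ⟨A, B, i, j, rfl, h, rfl⟩)

theorem sandwich_mem_relSpan {S T : Set (List ι)} {A B : List ι}
    (hST : ∀ w ∈ S, A ++ w ++ B ∈ T) {t : TensorAlgebra κ M} (ht : t ∈ relSpan e red ρ S) :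
    word e A * t * word e B ∈ relSpan e red ρ T := by
  refine mul_mul_mem_of_mem_span ht fun m hm => ?_
  obtain ⟨_, hw, A', B', i, j, rfl, hij, rfl⟩ := Set.mem_iUnion₂.1 hm
  have hmem := word_mul_mul_word_mem_relSpan (e := e) (ρ := ρ) (A := A ++ A') (B := B' ++ B) hij
    (by simpa only [append_assoc, cons_append] using hST _ hw)
  simpa only [word_append, mul_assoc] using hmem

theorem relSpan_univ :
    relSpan e red ρ Set.univ = ⊤ * Submodule.span κ {m | ∃ i j, red i j ∧ m = ρ i j} * ⊤ := by
  rw [← span_range_word e, Submodule.span_mul_span, Submodule.span_mul_span, relSpan]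
  congr 1
  ext m
  simp only [Set.mem_univ, Set.iUnion_true, Set.mem_iUnion, wordRels]
  constructor
  · rintro ⟨_, A, B, i, j, -, h, rfl⟩
    exact Set.mul_mem_mul (Set.mul_mem_mul ⟨A, rfl⟩ ⟨i, j, h, rfl⟩) ⟨B, rfl⟩
  · rintro ⟨_, ⟨_, ⟨A, rfl⟩, _, ⟨i, j, h, rfl⟩, rfl⟩, _, ⟨B, rfl⟩, rfl⟩
    exact ⟨_, A, B, i, j, rfl, h, rfl⟩

theorem wordRels_eq_empty_iff {w : List ι} :
    wordRels e red ρ w = ∅ ↔ w.IsChain fun i j => ¬ red i j := by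
  rw [isChain_iff_forall_rel_of_append_cons_cons, Set.eq_empty_iff_forall_notMem]
  constructor
  · exact fun h i j A B hw hij => h _ ⟨A, B, i, j, hw, hij, rfl⟩
  · rintro h _ ⟨A, B, i, j, hw, hij, -⟩
    exact h hw hij

variable [LT ι]

variable (e) in
/-- The span of the words that are smaller than `w` in the length-lexicographic order. -/
def wordsBelow (w : List ι) : Submodule κ (TensorAlgebra κ M) :=
  Submodule.span κ (word e '' {v | Shortlex (· < ·) v w})

variable (e red ρ) in
/-- The multiples of quadratic relations with a leading term below `w`. -/
abbrev relsBelow (w : List ι) : Submodule κ (TensorAlgebra κ M) :=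
  relSpan e red ρ {v | Shortlex (· < ·) v w}

theorem sandwich_mem_relsBelow {w A B : List ι} {t : TensorAlgebra κ M}
    (ht : t ∈ relsBelow e red ρ w) : word e A * t * word e B ∈ relsBelow e red ρ (A ++ w ++ B) :=
  sandwich_mem_relSpan (fun _ hv => shortlex_append_append hv A B) ht

theorem sub_word_mem_wordsBelow_of_mem_wordRels
    (hlead : ∀ ⦃i j⦄, red i j → ρ i j - word e [i, j] ∈ wordsBelow e [i, j])
    {w : List ι} {m : TensorAlgebra κ M} (hm : m ∈ wordRels e red ρ w) :
    m - word e w ∈ wordsBelow e w := by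
  obtain ⟨A, B, i, j, rfl, hij, rfl⟩ := hm
  have hmul : word e A * (ρ i j - word e [i, j]) * word e B ∈
      wordsBelow e (A ++ i :: j :: B) := by
    refine mul_mul_mem_of_mem_span (hlead hij) ?_
    rintro _ ⟨v, hv, rfl⟩
    rw [← word_append, ← word_append]
    refine Submodule.subset_span ⟨_, ?_, rfl⟩
    simpa using shortlex_append_append hv A B
  simpa only [mul_sub, sub_mul, ← word_append, append_assoc, cons_append, nil_append] using hmul

theorem disjoint_sub_mem_relsBelow
    (hlead : ∀ ⦃i j⦄, red i j → ρ i j - word e [i, j] ∈ wordsBelow e [i, j])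
    {i j k l : ι} (hij : red i j) (hkl : red k l) (C : List ι) :
    ρ i j * word e (C ++ [k, l]) - word e (i :: j :: C) * ρ k l ∈
      relsBelow e red ρ (i :: j :: C ++ [k, l]) := by
  have hright : ρ i j * word e C * (ρ k l - word e [k, l]) * 1 ∈
      relsBelow e red ρ (i :: j :: C ++ [k, l]) := by
    refine mul_mul_mem_of_mem_span (hlead hkl) ?_
    rintro _ ⟨v, hv, rfl⟩
    have := word_mul_mul_word_mem_relSpan (e := e) (ρ := ρ) (A := []) (B := C ++ v) hij
      (S := {v | Shortlex (· < ·) v (i :: j :: C ++ [k, l])})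
      (Shortlex.append_left hv (i :: j :: C))
    simpa only [word_nil, word_append, one_mul, mul_one, mul_assoc] using this
  have hleft : 1 * (ρ i j - word e [i, j]) * (word e C * ρ k l) ∈
      relsBelow e red ρ (i :: j :: C ++ [k, l]) := by
    refine mul_mul_mem_of_mem_span (hlead hij) ?_
    rintro _ ⟨v, hv, rfl⟩
    have := word_mul_mul_word_mem_relSpan (e := e) (ρ := ρ) (A := v ++ C) (B := []) hkl
      (S := {v | Shortlex (· < ·) v (i :: j :: C ++ [k, l])})
      (by simpa using shortlex_append_append hv [] (C ++ [k, l]))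
    simpa only [word_nil, word_append, one_mul, mul_one, mul_assoc] using this
  convert sub_mem hleft hright using 1
  simp only [word_append, word_cons, word_nil]
  noncomm_ring

theorem prefix_sub_mem_relsBelow
    (hlead : ∀ ⦃i j⦄, red i j → ρ i j - word e [i, j] ∈ wordsBelow e [i, j])
    (hoverlap : ∀ ⦃i j k⦄, red i j → red j k →
      ρ i j * TensorAlgebra.ι κ (e k) - TensorAlgebra.ι κ (e i) * ρ j k ∈
        relsBelow e red ρ [i, j, k])
    {A B B' C : List ι} {i j k l : ι} (hij : red i j) (hkl : red k l)
    (h : i :: j :: B = C ++ k :: l :: B') :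
    word e A * ρ i j * word e B - word e (A ++ C) * ρ k l * word e B' ∈
      relsBelow e red ρ (A ++ i :: j :: B) := by
  match C, h with
  | [], h =>
    obtain ⟨rfl, rfl, rfl⟩ : i = k ∧ j = l ∧ B = B' := by simpa using h
    simp only [append_nil, sub_self, zero_mem]
  | [m], h =>
    obtain ⟨rfl, rfl, rfl⟩ : i = m ∧ j = k ∧ B = l :: B' := by simpa using h
    have := sandwich_mem_relsBelow (A := A) (B := B') (hoverlap hij hkl)
    simpa only [word_append, word_cons, word_nil, mul_one, mul_sub, sub_mul, mul_assoc,
      append_assoc, cons_append, nil_append] using this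
  | m :: m' :: C, h =>
    obtain ⟨rfl, rfl, rfl⟩ : i = m ∧ j = m' ∧ B = C ++ k :: l :: B' := by simpa using h
    have := sandwich_mem_relsBelow (A := A) (B := B') (disjoint_sub_mem_relsBelow hlead hij hkl C)
    simpa only [word_append, word_cons, word_nil, mul_one, mul_sub, sub_mul, mul_assoc,
      append_assoc, cons_append, nil_append] using this

theorem sub_mem_relsBelow_of_mem_wordRels
    (hlead : ∀ ⦃i j⦄, red i j → ρ i j - word e [i, j] ∈ wordsBelow e [i, j])
    (hoverlap : ∀ ⦃i j k⦄, red i j → red j k →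
      ρ i j * TensorAlgebra.ι κ (e k) - TensorAlgebra.ι κ (e i) * ρ j k ∈
        relsBelow e red ρ [i, j, k])
    {w : List ι} {m m' : TensorAlgebra κ M} (hm : m ∈ wordRels e red ρ w)
    (hm' : m' ∈ wordRels e red ρ w) : m - m' ∈ relsBelow e red ρ w := by
  obtain ⟨A, B, i, j, hw, hij, rfl⟩ := hm
  obtain ⟨A', B', k, l, hw', hkl, rfl⟩ := hm'
  rcases append_eq_append_iff.1 (hw.symm.trans hw') with ⟨C, rfl, hC⟩ | ⟨C, rfl, hC⟩
  · rw [hw]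
    exact prefix_sub_mem_relsBelow hlead hoverlap hij hkl hC
  · rw [hw', ← neg_mem_iff, neg_sub]
    exact prefix_sub_mem_relsBelow hlead hoverlap hkl hij hC

variable [WellFoundedLT ι]

instance : IsWellFounded (List ι) (Shortlex ((· < ·) : ι → ι → Prop)) :=
  ⟨Shortlex.wf wellFounded_lt⟩

theorem exists_basis_of_quadratic_relations
    (hlead : ∀ ⦃i j⦄, red i j → ρ i j - word e [i, j] ∈ wordsBelow e [i, j])
    (hoverlap : ∀ ⦃i j k⦄, red i j → red j k →
      ρ i j * TensorAlgebra.ι κ (e k) - TensorAlgebra.ι κ (e i) * ρ j k ∈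
        relsBelow e red ρ [i, j, k])
    {f : TensorAlgebra κ M →ₗ[κ] N} (hf : Function.Surjective f)
    (hker : LinearMap.ker f = relSpan e red ρ Set.univ) :
    ∃ B : Module.Basis {w : List ι // w.IsChain fun i j => ¬ red i j} κ N,
      ∀ w, B w = f (word e w) := by
  obtain ⟨b, hb⟩ := exists_wordBasis e
  obtain ⟨B, hB⟩ := exists_basis_of_confluent (Shortlex (· < ·)) (b := b) (P := wordRels e red ρ)
    (fun w m hm => by
      rw [hb]
      exact sub_word_mem_wordsBelow_of_mem_wordRels hlead hm)
    (fun w m hm m' hm' => sub_mem_relsBelow_of_mem_wordRels hlead hoverlap hm hm') hf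
    (by rw [hker, relSpan, Set.biUnion_univ])
  exact ⟨B.reindex (Equiv.subtypeEquivRight fun w => wordRels_eq_empty_iff),
    fun w => by rw [Module.Basis.reindex_apply, hB, hb]; rfl⟩

theorem map_word_mem_span_irreducible
    (hlead : ∀ ⦃i j⦄, red i j → ρ i j - word e [i, j] ∈ wordsBelow e [i, j])
    {f : TensorAlgebra κ M →ₗ[κ] N} (hker : relSpan e red ρ Set.univ ≤ LinearMap.ker f)
    (w : List ι) : f (word e w) ∈ Submodule.span κ ((fun v => f (word e v)) ''
      {v | v.IsChain (fun i j => ¬ red i j) ∧ v.length ≤ w.length}) := by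
  obtain ⟨b, hb⟩ := exists_wordBasis e
  have := mem_span_irreducible (Shortlex ((· < ·) : ι → ι → Prop)) (b := b) (P := wordRels e red ρ)
    (fun w m hm => by
      rw [hb]
      exact sub_word_mem_wordsBelow_of_mem_wordRels hlead hm)
    (deg := List.length) (fun v w h => ?_) (f := f)
    (fun w m hm => hker (Submodule.subset_span (Set.mem_biUnion (Set.mem_univ w) hm))) w
  · simpa only [hb, wordRels_eq_empty_iff] using this
  · rcases shortlex_def.1 h with h | ⟨h, -⟩
    exacts [h.le, h.le]

end QuadraticRelations

namespace LieSuperalgebra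

section CommutatorRelations

variable {κ g : Type*} [Field κ] [AddCommGroup g] [Module κ g]

variable (κ) in
/-- The sign `(-1) ^ (αβ)` of the interchange of elements of parities `α` and `β`. -/
def koszulSign (α β : ZMod 2) : κ := (-1) ^ (α.val * β.val)

theorem koszulSign_comm (α β : ZMod 2) : koszulSign κ α β = koszulSign κ β α := by
  rw [koszulSign, koszulSign, mul_comm]

theorem koszulSign_one_one : koszulSign κ 1 1 = -1 := by
  rw [koszulSign, ZMod.val_one, mul_one, pow_one]

theorem koszulSign_zero_left (β : ZMod 2) : koszulSign κ 0 β = 1 := by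
  rw [koszulSign, ZMod.val_zero, zero_mul, pow_zero]

theorem koszulSign_zero_right (α : ZMod 2) : koszulSign κ α 0 = 1 := by
  rw [koszulSign_comm, koszulSign_zero_left]

theorem parity_cases (α : ZMod 2) : α = 0 ∨ α = 1 := by
  revert α; decide

theorem koszulSign_mul_self (α β : ZMod 2) : koszulSign κ α β * koszulSign κ α β = 1 := by
  rw [koszulSign, ← mul_pow, neg_one_mul, neg_neg, one_pow]

variable (L : LieSuperalgebra κ g)

theorem bracket_skew {α β : ZMod 2} {a b : g} (ha : a ∈ L.grade α) (hb : b ∈ L.grade β) :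
    L.bracket a b = -(koszulSign κ α β • L.bracket b a) :=
  L.skew α β a b ha hb

/-- The supercommutator relation `a ⊗ b - (-1) ^ (αβ) b ⊗ a - [a, b]` for elements of parities `α`
and `β`, bilinear in `a` and `b`. -/
noncomputable def commRel (α β : ZMod 2) : g →ₗ[κ] g →ₗ[κ] TensorAlgebra κ g :=
  let m := (LinearMap.mul κ (TensorAlgebra κ g)).compl₁₂ (TensorAlgebra.ι κ) (TensorAlgebra.ι κ)
  m - koszulSign κ α β • m.flip - L.bracket.compr₂ (TensorAlgebra.ι κ)

theorem commRel_apply (α β : ZMod 2) (a b : g) :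
    L.commRel α β a b = TensorAlgebra.ι κ a * TensorAlgebra.ι κ b -
      koszulSign κ α β • (TensorAlgebra.ι κ b * TensorAlgebra.ι κ a) -
      TensorAlgebra.ι κ (L.bracket a b) :=
  rfl

theorem commRel_skew {α β : ZMod 2} {a b : g} (ha : a ∈ L.grade α) (hb : b ∈ L.grade β) :
    L.commRel α β a b = -(koszulSign κ α β • L.commRel β α b a) := by
  simp only [commRel_apply, L.bracket_skew ha hb, koszulSign_comm β α, map_neg, map_smul, smul_sub,
    smul_smul, koszulSign_mul_self]
  module

theorem commRel_syzygy {α β γ : ZMod 2} {a b c : g} (ha : a ∈ L.grade α) (hb : b ∈ L.grade β) :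
    L.commRel α β a b * TensorAlgebra.ι κ c - TensorAlgebra.ι κ a * L.commRel β γ b c +
      koszulSign κ α β • (TensorAlgebra.ι κ b * L.commRel α γ a c) +
      (koszulSign κ α β * koszulSign κ α γ) • (L.commRel β γ b c * TensorAlgebra.ι κ a) -
      koszulSign κ β γ • (L.commRel α γ a c * TensorAlgebra.ι κ b) -
      (koszulSign κ β γ * koszulSign κ α γ) • (TensorAlgebra.ι κ c * L.commRel α β a b) =
    -L.commRel (α + β) γ (L.bracket a b) c + L.commRel α (β + γ) a (L.bracket b c) -
      koszulSign κ α β • L.commRel β (α + γ) b (L.bracket a c) := by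
  have hjacobi : L.bracket a (L.bracket b c) = L.bracket (L.bracket a b) c +
      koszulSign κ α β • L.bracket b (L.bracket a c) := L.jacobi α β a b c ha hb
  have h2 : (1 : ZMod 2) + 1 = 0 := rfl
  simp only [commRel_apply, hjacobi, map_add, map_smul]
  rcases parity_cases α with rfl | rfl <;> rcases parity_cases β with rfl | rfl <;>
    rcases parity_cases γ with rfl | rfl <;>
    simp only [koszulSign_one_one, koszulSign_zero_left, koszulSign_zero_right, add_zero, zero_add,
      h2, mul_sub, sub_mul, mul_assoc, one_smul, neg_smul, mul_neg, neg_mul, mul_one,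
      neg_neg] <;> abel

variable {L} {ι : Type*} {e : Module.Basis ι κ g} {par : ι → ZMod 2}

theorem span_image_eq_grade (he : ∀ i, e i ∈ L.grade (par i)) (α : ZMod 2) :
    Submodule.span κ (e '' {i | par i = α}) = L.grade α := by
  have hle : ∀ β, Submodule.span κ (e '' {i | par i = β}) ≤ L.grade β := fun β =>
    Submodule.span_le.2 (Set.image_subset_iff.2 fun i (hi : par i = β) => hi ▸ he i)
  refine (hle α).antisymm fun a ha => ?_
  have htop : a ∈ Submodule.span κ (e '' {i | par i = α}) ⊔
      Submodule.span κ (e '' {i | par i = α + 1}) := by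
    have hcover : {i | par i = α} ∪ {i | par i = α + 1} = Set.univ :=
      Set.eq_univ_of_forall fun i =>
        (by decide : ∀ β γ : ZMod 2, β = γ ∨ β = γ + 1) (par i) α
    rw [← Submodule.span_union, ← Set.image_union, hcover, Set.image_univ, e.span_eq]
    trivial
  obtain ⟨a', ha', a'', ha'', rfl⟩ := Submodule.mem_sup.1 htop
  have hdisj : Disjoint (L.grade α) (L.grade (α + 1)) :=
    L.isInternal.submodule_iSupIndep.pairwiseDisjoint
      ((by decide : ∀ β : ZMod 2, β ≠ β + 1) α)
  have hzero : a'' = 0 := Submodule.disjoint_def.1 hdisj a''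
    ((Submodule.add_mem_iff_right _ (hle α ha')).1 ha) (hle _ ha'')
  rwa [hzero, add_zero]

variable (L e par) in
/-- The supercommutator relation of two vectors of a homogeneous basis. -/
noncomputable abbrev basisRel (i j : ι) : TensorAlgebra κ g :=
  L.commRel (par i) (par j) (e i) (e j)

theorem commRel_mem_of_basisRel_mem (he : ∀ i, e i ∈ L.grade (par i))
    {N : Submodule κ (TensorAlgebra κ g)} (h : ∀ i j, basisRel L e par i j ∈ N)
    {α β : ZMod 2} {a b : g} (ha : a ∈ L.grade α) (hb : b ∈ L.grade β) :
    L.commRel α β a b ∈ N := by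
  rw [← span_image_eq_grade he] at ha hb
  refine LinearMap.BilinMap.apply_apply_mem_of_mem_span N _ _ (L.commRel α β) ?_ _ _ ha hb
  rintro _ ⟨i, rfl, rfl⟩ _ ⟨j, rfl, rfl⟩
  exact h i j

end CommutatorRelations

section SuperPBW

open List

variable {κ g : Type*} [Field κ] [AddCommGroup g] [Module κ g] (L : LieSuperalgebra κ g)
  {ι : Type*} [LinearOrder ι] (e : Module.Basis ι κ g) (par : ι → ZMod 2)

/-- The two-letter words `i j` that do not occur in a standard monomial: those in the wrong order,
and the squares of odd letters. -/
def Reducible (i j : ι) : Prop := j < i ∨ j = i ∧ par i = 1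

/-- The relation between two basis vectors, normalised so that `i j` has coefficient `1` when it is
reducible: for `i = j` odd the supercommutator relation is `2 e_i ⊗ e_i - [e_i, e_i]`. -/
noncomputable def pbwRel (i j : ι) : TensorAlgebra κ g :=
  (if i = j then (2 : κ)⁻¹ else 1) • basisRel L e par i j

variable {L e par}

theorem basisRel_mem_of_reducible (h2 : (2 : κ) ≠ 0) (he : ∀ i, e i ∈ L.grade (par i))
    {N : Submodule κ (TensorAlgebra κ g)} {i j : ι}
    (hij : Reducible par i j → basisRel L e par i j ∈ N)
    (hji : Reducible par j i → basisRel L e par j i ∈ N) : basisRel L e par i j ∈ N := by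
  have hskew : basisRel L e par i j = -(koszulSign κ (par i) (par j) • basisRel L e par j i) :=
    L.commRel_skew (he i) (he j)
  rcases lt_trichotomy i j with h | rfl | h
  · rw [hskew]
    exact neg_mem (N.smul_mem _ (hji (Or.inl h)))
  · rcases parity_cases (par i) with heven | hodd
    · rw [heven, koszulSign_zero_left, one_smul, eq_neg_iff_add_eq_zero, ← two_smul κ,
        smul_eq_zero_iff_right h2] at hskew
      exact hskew ▸ N.zero_mem
    · exact hij (Or.inr ⟨rfl, hodd⟩)
  · exact hij (Or.inl h)

theorem basisRel_eq_smul_pbwRel (h2 : (2 : κ) ≠ 0) (i j : ι) :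
    basisRel L e par i j = (if i = j then (2 : κ) else 1) • pbwRel L e par i j := by
  rw [pbwRel, smul_smul]
  split_ifs
  · rw [mul_inv_cancel₀ h2, one_smul]
  · rw [one_mul, one_smul]

theorem span_pbwRel (h2 : (2 : κ) ≠ 0) (he : ∀ i, e i ∈ L.grade (par i)) :
    Submodule.span κ {m | ∃ i j, Reducible par i j ∧ m = pbwRel L e par i j} =
      Submodule.span κ {m | ∃ a b, L.URel a b ∧ m = a - b} := by
  have hcomm : ∀ α β a b, L.commRel α β a b = TensorAlgebra.ι κ a * TensorAlgebra.ι κ b -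
      (TensorAlgebra.ι κ (L.bracket a b) +
        koszulSign κ α β • (TensorAlgebra.ι κ b * TensorAlgebra.ι κ a)) := fun α β a b => by
    rw [commRel_apply, sub_right_comm, sub_sub]
  refine le_antisymm (Submodule.span_le.2 ?_) (Submodule.span_le.2 ?_)
  · rintro _ ⟨i, j, -, rfl⟩
    exact Submodule.smul_mem _ _
      (Submodule.subset_span ⟨_, _, .mk _ _ _ _ (he i) (he j), hcomm _ _ _ _⟩)
  · rintro _ ⟨_, _, ⟨α, β, a, b, ha, hb⟩, rfl⟩
    have hred : ∀ i j, Reducible par i j → basisRel L e par i j ∈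
        Submodule.span κ {m | ∃ i j, Reducible par i j ∧ m = pbwRel L e par i j} := by
      intro i j h
      rw [basisRel_eq_smul_pbwRel h2]
      exact Submodule.smul_mem _ _ (Submodule.subset_span ⟨i, j, h, rfl⟩)
    have := commRel_mem_of_basisRel_mem he
      (fun i j => basisRel_mem_of_reducible h2 he (hred i j) (hred j i)) ha hb
    rwa [hcomm] at this

theorem ker_mkAlgHom_URel (h2 : (2 : κ) ≠ 0) (he : ∀ i, e i ∈ L.grade (par i)) :
    LinearMap.ker (RingQuot.mkAlgHom κ L.URel).toLinearMap =
      relSpan e (Reducible par) (pbwRel L e par) Set.univ := by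
  rw [ker_ringQuot_mkAlgHom, relSpan_univ, span_pbwRel h2 he]

theorem word_mul_basisRel_mul_word_mem_relSpan (h2 : (2 : κ) ≠ 0)
    (he : ∀ i, e i ∈ L.grade (par i)) {S : Set (List ι)} {i j : ι} {A B : List ι}
    (hij : A ++ i :: j :: B ∈ S) (hji : A ++ j :: i :: B ∈ S) :
    word e A * basisRel L e par i j * word e B ∈
      relSpan e (Reducible par) (pbwRel L e par) S := by
  have hred : ∀ {i j}, A ++ i :: j :: B ∈ S → Reducible par i j →
      basisRel L e par i j ∈ (relSpan e (Reducible par) (pbwRel L e par) S).comap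
        (LinearMap.mulLeftRight κ (word e A, word e B)) := by
    intro i j hS h
    rw [basisRel_eq_smul_pbwRel h2]
    refine Submodule.smul_mem _ _ (word_mul_mul_word_mem_relSpan h hS)
  exact basisRel_mem_of_reducible h2 he (hred hij) (hred hji)

theorem commRel_mem_relsBelow (h2 : (2 : κ) ≠ 0) (he : ∀ i, e i ∈ L.grade (par i))
    {w : List ι} (hw : 2 < w.length) {α β : ZMod 2} {a b : g}
    (ha : a ∈ L.grade α) (hb : b ∈ L.grade β) :
    L.commRel α β a b ∈ relsBelow e (Reducible par) (pbwRel L e par) w := by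
  refine commRel_mem_of_basisRel_mem he (fun i j => ?_) ha hb
  have := word_mul_basisRel_mul_word_mem_relSpan (i := i) (j := j) (A := []) (B := [])
    (S := {v | Shortlex (· < ·) v w}) h2 he (Shortlex.of_length_lt hw) (Shortlex.of_length_lt hw)
  rwa [word_nil, one_mul, mul_one] at this

theorem ι_mul_basisRel_mem_relsBelow (h2 : (2 : κ) ≠ 0) (he : ∀ i, e i ∈ L.grade (par i))
    {i j k l x y : ι} (hxy : Lex (· < ·) [l, x, y] [i, j, k])
    (hyx : Lex (· < ·) [l, y, x] [i, j, k]) :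
    TensorAlgebra.ι κ (e l) * basisRel L e par x y ∈
      relsBelow e (Reducible par) (pbwRel L e par) [i, j, k] := by
  have := word_mul_basisRel_mul_word_mem_relSpan (A := [l]) (i := x) (j := y) (B := []) h2 he
    (S := {v | Shortlex (· < ·) v [i, j, k]}) (Shortlex.of_lex rfl hxy) (Shortlex.of_lex rfl hyx)
  rwa [word_cons, word_nil, mul_one, mul_one] at this

theorem basisRel_mul_ι_mem_relsBelow (h2 : (2 : κ) ≠ 0) (he : ∀ i, e i ∈ L.grade (par i))
    {i j k l x y : ι} (hxy : Lex (· < ·) [x, y, l] [i, j, k])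
    (hyx : Lex (· < ·) [y, x, l] [i, j, k]) :
    basisRel L e par x y * TensorAlgebra.ι κ (e l) ∈
      relsBelow e (Reducible par) (pbwRel L e par) [i, j, k] := by
  have := word_mul_basisRel_mul_word_mem_relSpan (A := []) (i := x) (j := y) (B := [l]) h2 he
    (S := {v | Shortlex (· < ·) v [i, j, k]}) (Shortlex.of_lex rfl hxy) (Shortlex.of_lex rfl hyx)
  rwa [word_cons, word_nil, one_mul, mul_one] at this

theorem syzygy_mem_relsBelow (h2 : (2 : κ) ≠ 0) (he : ∀ i, e i ∈ L.grade (par i)) (i j k : ι) :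
    basisRel L e par i j * TensorAlgebra.ι κ (e k) -
      TensorAlgebra.ι κ (e i) * basisRel L e par j k +
      koszulSign κ (par i) (par j) • (TensorAlgebra.ι κ (e j) * basisRel L e par i k) +
      (koszulSign κ (par i) (par j) * koszulSign κ (par i) (par k)) •
        (basisRel L e par j k * TensorAlgebra.ι κ (e i)) -
      koszulSign κ (par j) (par k) • (basisRel L e par i k * TensorAlgebra.ι κ (e j)) -
      (koszulSign κ (par j) (par k) * koszulSign κ (par i) (par k)) •
        (TensorAlgebra.ι κ (e k) * basisRel L e par i j) ∈
    relsBelow e (Reducible par) (pbwRel L e par) [i, j, k] := by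
  rw [commRel_syzygy L (he i) (he j)]
  have hmem : ∀ {α β : ZMod 2} {a b : g}, a ∈ L.grade α → b ∈ L.grade β →
      L.commRel α β a b ∈ relsBelow e (Reducible par) (pbwRel L e par) [i, j, k] :=
    commRel_mem_relsBelow h2 he (by simp)
  exact sub_mem (add_mem (neg_mem (hmem (L.bracket_mem _ _ _ _ (he i) (he j)) (he k)))
    (hmem (he i) (L.bracket_mem _ _ _ _ (he j) (he k))))
    (Submodule.smul_mem _ _ (hmem (he j) (L.bracket_mem _ _ _ _ (he i) (he k))))

-- In each case the terms of the syzygy other than the two to be compared have leading terms below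
-- `i j k`, so they may be discarded.
theorem pbwRel_overlap (h2 : (2 : κ) ≠ 0) (h3 : (3 : κ) ≠ 0) (he : ∀ i, e i ∈ L.grade (par i))
    {i j k : ι} (hij : Reducible par i j) (hjk : Reducible par j k) :
    pbwRel L e par i j * TensorAlgebra.ι κ (e k) - TensorAlgebra.ι κ (e i) * pbwRel L e par j k ∈
      relsBelow e (Reducible par) (pbwRel L e par) [i, j, k] := by
  have hsyz := syzygy_mem_relsBelow (L := L) h2 he i j k
  set N := relsBelow e (Reducible par) (pbwRel L e par) [i, j, k]
  have hleft : ∀ l x y : ι, Lex (· < ·) [l, x, y] [i, j, k] → Lex (· < ·) [l, y, x] [i, j, k] →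
      TensorAlgebra.ι κ (e l) * basisRel L e par x y ∈ N :=
    fun _ _ _ => ι_mul_basisRel_mem_relsBelow h2 he
  have hright : ∀ x y l : ι, Lex (· < ·) [x, y, l] [i, j, k] → Lex (· < ·) [y, x, l] [i, j, k] →
      basisRel L e par x y * TensorAlgebra.ι κ (e l) ∈ N :=
    fun _ _ _ => basisRel_mul_ι_mem_relsBelow h2 he
  clear_value N
  rcases hij with hij | ⟨rfl, hi⟩ <;> rcases hjk with hjk | ⟨rfl, hj⟩
  · have hki := hjk.trans hij
    convert add_mem (add_mem (sub_mem (sub_mem hsyz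
      (N.smul_mem (koszulSign κ (par i) (par j)) (hleft j i k (.rel hij) (.rel hij))))
      (N.smul_mem (koszulSign κ (par i) (par j) * koszulSign κ (par i) (par k))
        (hright j k i (.rel hij) (.rel hki))))
      (N.smul_mem (koszulSign κ (par j) (par k)) (hright i k j (.cons (.rel hjk)) (.rel hki))))
      (N.smul_mem (koszulSign κ (par j) (par k) * koszulSign κ (par i) (par k))
        (hleft k i j (.rel hki) (.rel hki))) using 1
    simp only [pbwRel, hij.ne', hjk.ne', if_false, one_smul]
    module
  · convert sub_mem (sub_mem (N.smul_mem (2 : κ)⁻¹ hsyz)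
      (N.smul_mem (koszulSign κ (par i) (par k)) (hleft k i k (.rel hij) (.rel hij))))
      (N.smul_mem (2 : κ)⁻¹ (hright k k i (.rel hij) (.rel hij))) using 1
    simp only [pbwRel, hij.ne', if_false, if_true, one_smul, hj, koszulSign_one_one,
      koszulSign_mul_self, mul_smul_comm]
    match_scalars <;> field_simp <;> ring
  · convert add_mem (add_mem (N.smul_mem (2 : κ)⁻¹ hsyz)
      (N.smul_mem (koszulSign κ (par j) (par k)) (hright j k j (.cons (.rel hjk)) (.rel hjk))))
      (N.smul_mem (2 : κ)⁻¹ (hleft k j j (.rel hjk) (.rel hjk))) using 1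
    simp only [pbwRel, hjk.ne', if_false, if_true, one_smul, hi, koszulSign_one_one,
      koszulSign_mul_self, smul_mul_assoc]
    match_scalars <;> field_simp <;> ring
  · convert N.smul_mem ((2 : κ)⁻¹ * (3 : κ)⁻¹) hsyz using 1
    simp only [pbwRel, if_true, hi, koszulSign_one_one, smul_mul_assoc, mul_smul_comm]
    match_scalars <;> field_simp <;> ring

theorem pbwRel_sub_word_mem_wordsBelow (h2 : (2 : κ) ≠ 0) {i j : ι} (h : Reducible par i j) :
    pbwRel L e par i j - word e [i, j] ∈ wordsBelow e [i, j] := by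
  have hle : Submodule.span κ (Set.range e) ≤ (wordsBelow e [i, j]).comap (TensorAlgebra.ι κ) := by
    refine Submodule.span_le.2 (Set.range_subset_iff.2 fun k => ?_)
    refine Submodule.subset_span ⟨[k], Shortlex.of_length_lt (by simp), ?_⟩
    rw [word_cons, word_nil, mul_one]
  have hι : ∀ u : g, TensorAlgebra.ι κ u ∈ wordsBelow e [i, j] := fun u => hle (e.mem_span u)
  rcases h with hij | ⟨rfl, hodd⟩
  · have hji : word e [j, i] ∈ wordsBelow e [i, j] :=
      Submodule.subset_span ⟨[j, i], Shortlex.of_lex rfl (.rel hij), rfl⟩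
    convert sub_mem (neg_mem (Submodule.smul_mem _ (koszulSign κ (par i) (par j)) hji))
      (hι (L.bracket (e i) (e j))) using 1
    simp only [pbwRel, hij.ne', if_false, commRel_apply, word_cons, word_nil, mul_one]
    module
  · convert neg_mem (Submodule.smul_mem _ (2 : κ)⁻¹ (hι (L.bracket (e j) (e j)))) using 1
    simp only [pbwRel, if_true, commRel_apply, word_cons, word_nil, mul_one, hodd,
      koszulSign_one_one]
    match_scalars <;> field_simp
    norm_num

end SuperPBW

end LieSuperalgebra

section OrderedMonomials

open List

variable {ι A : Type*} [Monoid A]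

/-- The ordered monomial `∏ x i ^ F i`, with the factors in the order in which the list `l`
enumerates the indices. -/
def listMonomial (l : List ι) (x : ι → A) (F : ι → ℕ) : A := (l.map fun i => x i ^ F i).prod

/-- The word of which `listMonomial` is the product: `F i` copies of each letter `i` of `l`. -/
def expWord (l : List ι) (F : ι → ℕ) : List ι := l.flatMap fun i => replicate (F i) i

theorem orderedMonomial_eq_listMonomial {n : ℕ} (x : Fin n → A) (F : Fin n → ℕ) :
    orderedMonomial x F = listMonomial (finRange n) x F := by
  rw [orderedMonomial, listMonomial, ofFn_eq_map]

theorem prod_map_expWord (l : List ι) (x : ι → A) (F : ι → ℕ) :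
    ((expWord l F).map x).prod = listMonomial l x F := by
  rw [expWord, map_flatMap, listMonomial, flatMap, prod_flatten, map_map]
  simp only [Function.comp_def, map_replicate, prod_replicate]

theorem length_expWord (l : List ι) (F : ι → ℕ) : (expWord l F).length = (l.map F).sum := by
  simp only [expWord, length_flatMap, length_replicate]

theorem count_expWord [DecidableEq ι] {l : List ι} (hl : l.Nodup) (F : ι → ℕ) {i : ι}
    (hi : i ∈ l) : (expWord l F).count i = F i := by
  rw [expWord, count_flatMap, sum_map_eq_nsmul_single i, count_eq_one_of_mem hl hi]
  · simp
  · intro j hj _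
    rw [Function.comp_apply, count_replicate, if_neg (by simpa using hj)]

end OrderedMonomials

namespace LieSuperalgebra

section PBWBasis

open List

variable {κ g : Type*} [Field κ] [AddCommGroup g] [Module κ g] {L : LieSuperalgebra κ g}
  {ι : Type*} {e : Module.Basis ι κ g} {par : ι → ZMod 2}

theorem mkAlgHom_word (w : List ι) :
    RingQuot.mkAlgHom κ L.URel (word e w) = (w.map fun i => L.ιU (e i)).prod := by
  rw [word, map_list_prod, List.map_map]
  rfl

section LinearOrder

variable [LinearOrder ι]

theorem not_reducible_iff {i j : ι} : ¬ Reducible par i j ↔ i < j ∨ i = j ∧ par i ≠ 1 := by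
  rw [Reducible, not_or, not_lt, not_and, le_iff_lt_or_eq]
  grind

instance : IsTrans ι fun i j => ¬ Reducible par i j where
  trans i j k := by
    simp only [not_reducible_iff]
    rintro (h | ⟨rfl, h⟩) (h' | ⟨rfl, _⟩)
    exacts [Or.inl (h.trans h'), Or.inl h, Or.inl h', Or.inr ⟨rfl, h⟩]

theorem pairwise_expWord {l : List ι} (hl : l.Pairwise (· < ·)) {F : ι → ℕ}
    (hF : ∀ i, par i = 1 → F i < 2) : (expWord l F).Pairwise fun i j => ¬ Reducible par i j := by
  simp only [expWord, pairwise_flatMap, pairwise_replicate, not_reducible_iff]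
  refine ⟨fun i _ => ?_, hl.imp fun {i j} hij x hx y hy => ?_⟩
  · by_cases h : par i = 1
    · exact Or.inl (Nat.le_of_lt_succ (hF i h))
    · exact Or.inr (Or.inr ⟨trivial, h⟩)
  · rw [eq_of_mem_replicate hx, eq_of_mem_replicate hy]
    exact Or.inl hij

theorem count_lt_two {w : List ι} (hw : w.Pairwise fun i j => ¬ Reducible par i j) {i : ι}
    (hi : par i = 1) : w.count i < 2 := by
  by_contra h
  have hpair := hw.sublist (replicate_sublist_iff.2 (not_lt.1 h))
  exact (pairwise_cons.1 hpair).1 i (mem_singleton_self i) (Or.inr ⟨rfl, hi⟩)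

theorem expWord_count {l : List ι} (hl : l.Pairwise (· < ·)) (hmem : ∀ i, i ∈ l) {w : List ι}
    (hw : w.Pairwise fun i j => ¬ Reducible par i j) : expWord l (fun i => w.count i) = w := by
  have hle : ∀ {i j}, ¬ Reducible par i j → i ≤ j := fun h => not_lt.1 fun h' => h (Or.inl h')
  refine Perm.eq_of_pairwise (le := (· ≤ ·)) (fun a b _ _ => le_antisymm)
    ((pairwise_expWord hl fun i hi => count_lt_two hw hi).imp hle) (hw.imp hle)
    (perm_iff_count.2 fun i => ?_)
  rw [count_expWord (hl.imp ne_of_lt) _ (hmem i)]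

/-- Standard monomials are determined by their exponents. -/
def expWordEquiv {l : List ι} (hl : l.Pairwise (· < ·)) (hmem : ∀ i, i ∈ l) :
    {F : ι → ℕ // ∀ i, par i = 1 → F i < 2} ≃
      {w : List ι // w.IsChain fun i j => ¬ Reducible par i j} where
  toFun F := ⟨expWord l F.1, (pairwise_expWord hl F.2).isChain⟩
  invFun w := ⟨fun i => w.1.count i, fun _ => count_lt_two (isChain_iff_pairwise.1 w.2)⟩
  left_inv F := Subtype.ext (funext fun i => count_expWord (hl.imp ne_of_lt) F.1 (hmem i))
  right_inv w := Subtype.ext (expWord_count hl hmem (isChain_iff_pairwise.1 w.2))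

theorem exists_pbwBasis_of_pairwise_lt [WellFoundedLT ι] (h2 : (2 : κ) ≠ 0) (h3 : (3 : κ) ≠ 0)
    (he : ∀ i, e i ∈ L.grade (par i)) {l : List ι} (hl : l.Pairwise (· < ·))
    (hmem : ∀ i, i ∈ l) :
    ∃ B : Module.Basis {F : ι → ℕ // ∀ i, par i = 1 → F i < 2} κ L.UEnv,
      ∀ F, B F = listMonomial l (fun i => L.ιU (e i)) F := by
  obtain ⟨B, hB⟩ := exists_basis_of_quadratic_relations
    (fun _ _ => pbwRel_sub_word_mem_wordsBelow (L := L) (e := e) h2)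
    (fun _ _ _ => pbwRel_overlap h2 h3 he) (RingQuot.mkAlgHom_surjective κ L.URel)
    (ker_mkAlgHom_URel h2 he)
  refine ⟨B.reindex (expWordEquiv hl hmem).symm, fun F => ?_⟩
  rw [Module.Basis.reindex_apply, hB, Equiv.symm_symm, AlgHom.toLinearMap_apply, mkAlgHom_word,
    ← prod_map_expWord]
  rfl

theorem prod_mem_span_of_pairwise_lt [WellFoundedLT ι] (h2 : (2 : κ) ≠ 0)
    (he : ∀ i, e i ∈ L.grade (par i)) {l : List ι} (hl : l.Pairwise (· < ·))
    (hmem : ∀ i, i ∈ l) (w : List ι) :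
    (w.map fun i => L.ιU (e i)).prod ∈ Submodule.span κ (listMonomial l (fun i => L.ιU (e i)) ''
      {F | (∀ i, par i = 1 → F i < 2) ∧ (l.map F).sum ≤ w.length}) := by
  have hspan := map_word_mem_span_irreducible
    (fun _ _ => pbwRel_sub_word_mem_wordsBelow (L := L) (e := e) (par := par) h2)
    (ker_mkAlgHom_URel h2 he).ge w
  rw [AlgHom.toLinearMap_apply, mkAlgHom_word] at hspan
  refine Submodule.span_mono ?_ hspan
  rintro _ ⟨v, ⟨hv, hlen⟩, rfl⟩
  obtain ⟨F, hF⟩ := (expWordEquiv hl hmem).surjective ⟨v, hv⟩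
  obtain rfl : expWord l F.1 = v := congrArg Subtype.val hF
  rw [length_expWord] at hlen
  refine ⟨F, ⟨F.2, hlen⟩, ?_⟩
  dsimp only
  rw [AlgHom.toLinearMap_apply, mkAlgHom_word, prod_map_expWord]

end LinearOrder

theorem exists_linearOrder_of_nodup {l : List ι} (hl : l.Nodup) (hmem : ∀ i, i ∈ l) :
    ∃ _ : LinearOrder ι, WellFoundedLT ι ∧ l.Pairwise (· < ·) := by
  classical
  have : Fintype ι := Fintype.ofList l hmem
  refine ⟨LinearOrder.lift' (fun i => l.idxOf i) fun i j h => (idxOf_inj (hmem i)).1 h,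
    inferInstance, pairwise_iff_getElem.2 fun i j hi hj hij => ?_⟩
  change l.idxOf l[i] < l.idxOf l[j]
  rwa [hl.idxOf_getElem, hl.idxOf_getElem]

theorem exists_pbwBasis (h2 : (2 : κ) ≠ 0) (h3 : (3 : κ) ≠ 0) (he : ∀ i, e i ∈ L.grade (par i))
    {l : List ι} (hl : l.Nodup) (hmem : ∀ i, i ∈ l) :
    ∃ B : Module.Basis {F : ι → ℕ // ∀ i, par i = 1 → F i < 2} κ L.UEnv,
      ∀ F, B F = listMonomial l (fun i => L.ιU (e i)) F := by
  obtain ⟨_, _, hlt⟩ := exists_linearOrder_of_nodup hl hmem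
  exact exists_pbwBasis_of_pairwise_lt h2 h3 he hlt hmem

theorem prod_mem_span_listMonomial (h2 : (2 : κ) ≠ 0) (he : ∀ i, e i ∈ L.grade (par i))
    {l : List ι} (hl : l.Nodup) (hmem : ∀ i, i ∈ l) (w : List ι) :
    (w.map fun i => L.ιU (e i)).prod ∈ Submodule.span κ (listMonomial l (fun i => L.ιU (e i)) ''
      {F | (∀ i, par i = 1 → F i < 2) ∧ (l.map F).sum ≤ w.length}) := by
  obtain ⟨_, _, hlt⟩ := exists_linearOrder_of_nodup hl hmem
  exact prod_mem_span_of_pairwise_lt h2 he hlt hmem w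

end PBWBasis

end LieSuperalgebra

section Jacobson

open Polynomial

attribute [local instance] LieRing.ofAssociativeRing

theorem cast_choose_char_sub_one {S : Type*} [Ring S] (p : ℕ) [hp : Fact p.Prime] [CharP S p]
    {m : ℕ} (hm : m < p) : ((p - 1).choose m : S) = (-1) ^ m := by
  induction m with
  | zero => simp
  | succ m ih =>
    have pascal : p.choose (m + 1) = (p - 1).choose m + (p - 1).choose (m + 1) := by
      conv_lhs => rw [← Nat.sub_add_cancel hp.out.one_le, Nat.choose_succ_succ]
    have vanish : (p.choose (m + 1) : S) = 0 :=
      (CharP.cast_eq_zero_iff S p _).2 (hp.out.dvd_choose_self m.succ_ne_zero hm)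
    rw [pascal, Nat.cast_add, ih (Nat.lt_of_succ_lt hm)] at vanish
    rw [pow_succ, mul_neg_one, eq_neg_of_add_eq_zero_right vanish]

theorem sub_pow_char_sub_one_of_commute {S : Type*} [Ring S] (p : ℕ) [hp : Fact p.Prime]
    [CharP S p] {x y : S} (h : Commute x y) :
    (x - y) ^ (p - 1) = ∑ i ∈ Finset.range p, x ^ i * y ^ (p - 1 - i) := by
  have neg_one_pow : (-1 : S) ^ (p - 1) = 1 := by
    rw [← cast_choose_char_sub_one p (Nat.sub_lt hp.out.pos one_pos), Nat.choose_self, Nat.cast_one]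
  rw [sub_eq_add_neg, h.neg_right.add_pow, Nat.sub_add_cancel hp.out.one_le]
  refine Finset.sum_congr rfl fun i hi => ?_
  have hi' := Finset.mem_range.1 hi
  rw [cast_choose_char_sub_one p hi', mul_assoc, neg_pow y,
    ((Commute.neg_one_left _).pow_left _).eq, mul_assoc, ← pow_add,
    Nat.sub_add_cancel (Nat.le_sub_one_of_lt hi'), neg_one_pow, mul_one]

theorem derivative_pow_eq_sum {A : Type*} [Ring A] (D : A[X]) (n : ℕ) :
    derivative (D ^ n) = ∑ i ∈ Finset.range n, D ^ i * derivative D * D ^ (n - 1 - i) := by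
  induction n with
  | zero => simp
  | succ n ih =>
    rw [pow_succ, derivative_mul, ih, Finset.sum_range_succ, Finset.sum_mul, Nat.add_sub_cancel,
      Nat.sub_self, pow_zero, mul_one]
    congr 1
    refine Finset.sum_congr rfl fun i hi => ?_
    rw [mul_assoc, ← pow_succ, Nat.sub_right_comm, Nat.sub_add_cancel]
    exact Nat.sub_pos_of_lt (Finset.mem_range.1 hi)

variable {κ A : Type*} [Field κ] [Ring A] [Algebra κ A]

theorem ad_pow_char (p : ℕ) [Fact p.Prime] [CharP κ p] (u : A) :
    LieAlgebra.ad κ A u ^ p = LieAlgebra.ad κ A (u ^ p) := by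
  cases subsingleton_or_nontrivial A
  · exact Subsingleton.elim _ _
  have : CharP (Module.End κ A) p := charP_of_injective_algebraMap (algebraMap κ _).injective p
  simp only [LieAlgebra.ad_eq_lmul_left_sub_lmul_right, Pi.sub_apply]
  rw [sub_pow_char_of_commute p (LinearMap.commute_mulLeft_right u u),
    LinearMap.pow_mulLeft, LinearMap.pow_mulRight]

theorem ad_pow_char_sub_one_apply (p : ℕ) [Fact p.Prime] [CharP κ p] (u v : A) :
    (LieAlgebra.ad κ A u ^ (p - 1)) v = ∑ i ∈ Finset.range p, u ^ i * v * u ^ (p - 1 - i) := by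
  cases subsingleton_or_nontrivial A
  · exact Subsingleton.elim _ _
  have : CharP (Module.End κ A) p := charP_of_injective_algebraMap (algebraMap κ _).injective p
  simp only [LieAlgebra.ad_eq_lmul_left_sub_lmul_right, Pi.sub_apply]
  rw [sub_pow_char_sub_one_of_commute p (LinearMap.commute_mulLeft_right u u), LinearMap.sum_apply]
  simp only [LinearMap.pow_mulLeft, LinearMap.pow_mulRight, Module.End.mul_apply,
    LinearMap.mulLeft_apply, LinearMap.mulRight_apply, mul_assoc]

-- Both sides are the coefficients of the derivative of `(x X + y) ^ p`.
theorem coeff_ad_pow_char_sub_one (p : ℕ) [Fact p.Prime] [CharP κ p] (x y : A) (i : ℕ) :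
    ((LieAlgebra.ad κ A[X] (C x * X + C y) ^ (p - 1)) (C x)).coeff i =
      ((C x * X + C y) ^ p).coeff (i + 1) * (i + 1) := by
  rw [ad_pow_char_sub_one_apply, ← coeff_derivative, derivative_pow_eq_sum]
  simp only [derivative_add, derivative_C_mul, derivative_X, derivative_C, mul_one, add_zero]

theorem add_pow_eq_sum_coeff (x y : A) {n : ℕ} (hn : n ≠ 0) :
    (x + y) ^ n = x ^ n + y ^ n + ∑ i ∈ Finset.Icc 1 (n - 1), ((C x * X + C y) ^ n).coeff i := by
  obtain ⟨m, rfl⟩ := Nat.exists_eq_succ_of_ne_zero hn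
  set D : A[X] := C x * X + C y with hD
  have hdeg : D.natDegree ≤ 1 := natDegree_linear_le
  let evalOne : A[X] →+* A := eval₂RingHom' (RingHom.id A) 1 fun a => Commute.one_right a
  have hsum : (x + y) ^ (m + 1) = ∑ i ∈ Finset.range (m + 2), (D ^ (m + 1)).coeff i := by
    have hevalD : eval 1 D = x + y := by simp [hD]
    calc (x + y) ^ (m + 1) = eval 1 (D ^ (m + 1)) :=
          hevalD ▸ (map_pow evalOne D (m + 1)).symm
      _ = _ := by
        rw [eval_eq_sum_range' (n := m + 2) (by have := natDegree_pow_le_of_le (m + 1) hdeg; lia)]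
        simp only [one_pow, mul_one]
  have hbot : (D ^ (m + 1)).coeff 0 = y ^ (m + 1) := by
    rw [← constantCoeff_apply, map_pow]
    simp [hD]
  have htop : (D ^ (m + 1)).coeff (m + 1) = x ^ (m + 1) := by
    have := coeff_pow_of_natDegree_le (m := m + 1) hdeg
    rw [mul_one] at this
    rw [this]
    simp [hD]
  rw [hsum, Finset.sum_range_succ, htop, Finset.sum_range_succ', hbot, Finset.range_eq_Ico,
    Finset.sum_Ico_add' (fun i => (D ^ (m + 1)).coeff i), zero_add, Finset.Ico_add_one_right_eq_Icc,
    Nat.succ_eq_add_one, Nat.add_sub_cancel]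
  abel

end Jacobson

namespace LieSuperalgebra

section PthPowers

open Polynomial

attribute [local instance] LieRing.ofAssociativeRing

variable {κ g A : Type*} [Field κ] [AddCommGroup g] [Module κ g] {L : LieSuperalgebra κ g}
  [Ring A] [Algebra κ A]

theorem coeff_ad_pow_eq (f : g →ₗ[κ] A) {a b : g} (ha : ∀ v, f (L.bracket a v) = ⁅f a, f v⁆)
    (hb : ∀ v, f (L.bracket b v) = ⁅f b, f v⁆) (v : g) (m k : ℕ) :
    ((LieAlgebra.ad κ A[X] (C (f a) * X + C (f b)) ^ m) (C (f v))).coeff k =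
      f (((X * C (L.ad a) + C (L.ad b)) ^ m).coeff k v) := by
  induction m generalizing k with
  | zero =>
    simp only [pow_zero, Module.End.one_apply, coeff_C, coeff_one]
    split_ifs <;> simp
  | succ m ih =>
    have expand (h : A[X]) : ⁅C (f a) * X + C (f b), h⁆ =
        C (f a) * (X * h) - h * C (f a) * X + (C (f b) * h - h * C (f b)) := by
      rw [Ring.lie_def]
      noncomm_ring
    rw [pow_succ', pow_succ', Module.End.mul_apply, LieAlgebra.ad_apply, expand, add_mul,
      mul_assoc X]
    have hadA (v : g) : f (L.ad a v) = f a * f v - f v * f a := ha v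
    have hadB (v : g) : f (L.ad b v) = f b * f v - f v * f b := hb v
    cases k <;>
      simp only [coeff_add, coeff_sub, coeff_C_mul, coeff_mul_C, coeff_mul_X, coeff_X_mul,
        coeff_mul_X_zero, coeff_X_mul_zero, ih, hadA, hadB, LinearMap.add_apply,
        Module.End.mul_apply, f.map_add, mul_zero, sub_zero, LinearMap.zero_apply, f.map_zero]

/- Jacobson's formula: differentiating `(f a X + f b) ^ p` identifies its inner coefficients with
iterated commutators. -/
theorem add_pow_char_eq_jacobsonTerm (p : ℕ) [hp : Fact p.Prime] [CharP κ p] (f : g →ₗ[κ] A)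
    {a b : g} (ha : ∀ v, f (L.bracket a v) = ⁅f a, f v⁆)
    (hb : ∀ v, f (L.bracket b v) = ⁅f b, f v⁆) :
    (f a + f b) ^ p = f a ^ p + f b ^ p +
      f (∑ i ∈ Finset.Icc 1 (p - 1), L.jacobsonTerm p i a b) := by
  rw [add_pow_eq_sum_coeff _ _ hp.out.ne_zero, map_sum]
  congr 1
  refine Finset.sum_congr rfl fun i hi => ?_
  rw [Finset.mem_Icc] at hi
  obtain ⟨j, rfl⟩ := Nat.exists_eq_add_of_le' hi.1
  have hj : ((j + 1 : ℕ) : κ) ≠ 0 := fun h =>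
    Nat.not_dvd_of_pos_of_lt j.succ_pos (by omega) ((CharP.cast_eq_zero_iff κ p _).1 h)
  rw [jacobsonTerm, map_smul, Nat.add_sub_cancel, ← coeff_ad_pow_eq f ha hb,
    coeff_ad_pow_char_sub_one p, eq_inv_smul_iff₀ hj, Nat.cast_smul_eq_nsmul, nsmul_eq_mul,
    (Nat.cast_commute (j + 1) _).eq, Nat.cast_succ]

theorem ιU_mul_ιU {α β : ZMod 2} {a b : g} (ha : a ∈ L.grade α) (hb : b ∈ L.grade β) :
    L.ιU a * L.ιU b = L.ιU (L.bracket a b) + koszulSign κ α β • (L.ιU b * L.ιU a) := by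
  have := RingQuot.mkAlgHom_rel κ (URel.mk (L := L) α β a b ha hb)
  rwa [map_mul, map_add, map_smul, map_mul] at this

theorem ιU_bracket_even {a : g} (ha : a ∈ L.grade 0) (v : g) :
    L.ιU (L.bracket a v) = ⁅L.ιU a, L.ιU v⁆ := by
  have hv : v ∈ ⨆ i, L.grade i := L.isInternal.submodule_iSup_eq_top ▸ Submodule.mem_top
  induction hv using Submodule.iSup_induction' with
  | mem i x hx =>
    rw [Ring.lie_def, ιU_mul_ιU ha hx, koszulSign_zero_left, one_smul, add_sub_cancel_right]
  | zero => simp only [map_zero, lie_zero]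
  | add x y _ _ hx hy => rw [map_add, map_add, hx, hy, map_add, lie_add]

end PthPowers

end LieSuperalgebra

section LeadingTerms

variable {κ A ι : Type*} [Field κ] [Ring A] [Algebra κ A] {a : ι → A}

variable (κ a) in
/-- The span of the products of less than `d` of the elements `a i`: the filtration of an algebra
by the degree in a family of generators, shifted by one so that its term at `0` vanishes. -/
def degreeLT (d : ℕ) : Submodule κ A :=
  Submodule.span κ ((fun w : List ι => (w.map a).prod) '' {w | w.length < d})

theorem degreeLT_mono {d d' : ℕ} (h : d ≤ d') : degreeLT κ a d ≤ degreeLT κ a d' :=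
  Submodule.span_mono (Set.image_mono fun _ hw => lt_of_lt_of_le hw h)

theorem mul_mem_degreeLT {m k N : ℕ} (h : m + k ≤ N + 1) {u v : A} (hu : u ∈ degreeLT κ a m)
    (hv : v ∈ degreeLT κ a k) : u * v ∈ degreeLT κ a N := by
  have huv := Submodule.mul_mem_mul hu hv
  rw [degreeLT, degreeLT, Submodule.span_mul_span] at huv
  refine Submodule.span_mono ?_ huv
  rintro _ ⟨_, ⟨w, hw, rfl⟩, _, ⟨w', hw', rfl⟩, rfl⟩
  refine ⟨w ++ w', ?_, by simp⟩
  rw [Set.mem_ofPred_eq] at hw hw' ⊢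
  rw [List.length_append]
  omega

variable (κ a) in
/-- `v` has degree at most `m` in the elements `a i`, and `u` agrees with `v` up to terms of lower
degree. -/
def LeadingEq (m : ℕ) (u v : A) : Prop := u - v ∈ degreeLT κ a m ∧ v ∈ degreeLT κ a (m + 1)

namespace LeadingEq

theorem left_mem {m : ℕ} {u v : A} (h : LeadingEq κ a m u v) : u ∈ degreeLT κ a (m + 1) :=
  (Submodule.sub_mem_iff_left _ h.2).1 (degreeLT_mono m.le_succ h.1)

theorem mul {m k : ℕ} {u v u' v' : A} (h : LeadingEq κ a m u v) (h' : LeadingEq κ a k u' v') :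
    LeadingEq κ a (m + k) (u * u') (v * v') := by
  refine ⟨?_, mul_mem_degreeLT (by omega) h.2 h'.2⟩
  rw [← sub_add_sub_cancel _ (v * u'), ← sub_mul, ← mul_sub]
  exact add_mem (mul_mem_degreeLT (by omega) h.1 h'.left_mem)
    (mul_mem_degreeLT (by omega) h.2 h'.1)

theorem one : LeadingEq κ a 0 1 1 :=
  ⟨by rw [sub_self]; exact zero_mem _, Submodule.subset_span ⟨[], Nat.one_pos, List.prod_nil⟩⟩

theorem generator (i : ι) : LeadingEq κ a 1 (a i) (a i) :=
  ⟨by rw [sub_self]; exact zero_mem _, Submodule.subset_span ⟨[i], Nat.one_lt_two, by simp⟩⟩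

theorem pow {m : ℕ} {u v : A} (h : LeadingEq κ a m u v) (k : ℕ) :
    LeadingEq κ a (m * k) (u ^ k) (v ^ k) := by
  induction k with
  | zero => simpa only [pow_zero, mul_zero] using one
  | succ k ih =>
    rw [pow_succ, pow_succ, Nat.mul_succ]
    exact ih.mul h

theorem list_prod {l : List ι} {m : ι → ℕ} {u v : ι → A}
    (h : ∀ i, LeadingEq κ a (m i) (u i) (v i)) :
    LeadingEq κ a (l.map m).sum (l.map u).prod (l.map v).prod := by
  induction l with
  | nil => exact one
  | cons i l ih => simpa only [List.map_cons, List.sum_cons, List.prod_cons] using (h i).mul ih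

end LeadingEq

/-- The monomial `∏ a i ^ (F i % p) * c i ^ (F i / p)`, with the factors in the order given by `l`:
the analogue of `listMonomial l a F` in which each `a i ^ p` has been replaced by `c i`. -/
def mixedMonomial (p : ℕ) (l : List ι) (a c : ι → A) (F : ι → ℕ) : A :=
  (l.map fun i => a i ^ (F i % p) * c i ^ (F i / p)).prod

theorem leadingEq_mixedMonomial {p : ℕ} (l : List ι) {c : ι → A}
    (hc : ∀ i, c i - a i ^ p ∈ degreeLT κ a p) (F : ι → ℕ) :
    LeadingEq κ a (l.map F).sum (mixedMonomial p l a c F) (listMonomial l a F) := by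
  refine LeadingEq.list_prod fun i => ?_
  have hlead : LeadingEq κ a p (c i) (a i ^ p) :=
    ⟨hc i, by simpa only [one_mul] using ((LeadingEq.generator i).pow p).2⟩
  have := ((LeadingEq.generator i).pow (F i % p)).mul (hlead.pow (F i / p))
  rwa [← pow_mul, ← pow_add, one_mul, Nat.mod_add_div] at this

theorem exists_mixedMonomial_basis {P : (ι → ℕ) → Prop} {l : List ι}
    (B : Module.Basis {F // P F} κ A) (hB : ∀ F, B F = listMonomial l a F)
    (hspan : ∀ w : List ι, (w.map a).prod ∈
      Submodule.span κ (listMonomial l a '' {F | P F ∧ (l.map F).sum ≤ w.length}))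
    {p : ℕ} {c : ι → A} (hc : ∀ i, c i - a i ^ p ∈ degreeLT κ a p) :
    ∃ B' : Module.Basis {F // P F} κ A, ∀ F, B' F = mixedMonomial p l a c F := by
  let deg : {F // P F} → ℕ := fun F => (l.map F.1).sum
  have : IsWellFounded {F // P F} fun F G => deg F < deg G := ⟨(measure deg).wf⟩
  refine exists_basis_of_triangular (b := B) (fun F G => deg F < deg G) fun F => ?_
  rw [hB]
  refine (?_ : degreeLT κ a (deg F) ≤ _) (leadingEq_mixedMonomial l hc F.1).1
  refine Submodule.span_le.2 ?_
  rintro _ ⟨w, hw, rfl⟩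
  refine Submodule.span_mono ?_ (hspan w)
  rintro _ ⟨G, ⟨hG, hdeg⟩, rfl⟩
  exact ⟨⟨G, hG⟩, lt_of_le_of_lt hdeg hw, hB _⟩

end LeadingTerms

section CentralFactors

variable {A ι : Type*} [Monoid A]

theorem prod_map_eq_mul_of_commute {l : List ι} (hl : l.Nodup) {i : ι} (hi : i ∈ l)
    {f f' : ι → A} {z : A} (hz : ∀ u, Commute z u) (hf : ∀ j, j ≠ i → f' j = f j)
    (hfi : f' i = z * f i) : (l.map f').prod = z * (l.map f).prod := by
  obtain ⟨l₁, l₂, rfl⟩ := List.append_of_mem hi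
  rw [List.nodup_middle, List.nodup_cons, List.mem_append, not_or] at hl
  have hcongr {l' : List ι} (hl' : i ∉ l') : l'.map f' = l'.map f :=
    List.map_congr_left fun j hj => hf j (ne_of_mem_of_not_mem hj hl')
  simp only [List.map_append, List.map_cons, List.prod_append, List.prod_cons, hfi,
    hcongr hl.1.1, hcongr hl.1.2]
  rw [mul_assoc, ← mul_assoc _ z, ← (hz _).eq, mul_assoc]

theorem mixedMonomial_add_single {A : Type*} [Ring A] [DecidableEq ι] {p : ℕ} (hp : 0 < p)
    {l : List ι} (hl : l.Nodup) {i : ι} (hi : i ∈ l) {a c : ι → A} (hc : ∀ u, Commute (c i) u)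
    (F : ι → ℕ) :
    mixedMonomial p l a c (F + Pi.single i p) = c i * mixedMonomial p l a c F := by
  refine prod_map_eq_mul_of_commute hl hi hc (fun j hj => ?_) ?_
  · simp only [Pi.add_apply, Pi.single_eq_of_ne hj, add_zero]
  · rw [Pi.add_apply, Pi.single_eq_same, Nat.add_mod_right, Nat.add_div_right _ hp, pow_succ',
      ← mul_assoc, ← mul_assoc, (hc _).eq]

theorem mixedMonomial_of_lt {A : Type*} [Ring A] {p : ℕ} (l : List ι) (a c : ι → A) {F : ι → ℕ}
    (hF : ∀ i, F i < p) : mixedMonomial p l a c F = listMonomial l a F := by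
  simp only [mixedMonomial, listMonomial, Nat.mod_eq_of_lt (hF _), Nat.div_eq_of_lt (hF _),
    pow_zero, mul_one]

end CentralFactors

namespace LieSuperalgebra

section RestrictedPBWBasis

attribute [local instance] LieRing.ofAssociativeRing

variable {κ g : Type*} [Field κ] [AddCommGroup g] [Module κ g] {L : LieSuperalgebra κ g}
  {p : ℕ} {pm : L.grade 0 → L.grade 0}

variable (p pm) in
/-- The element `a ^ p - a^[p]` of the enveloping algebra, which is central when `pm` is a `p`-th
power map. -/
noncomputable def pCentral (a : L.grade 0) : L.UEnv := L.ιU a ^ p - L.ιU (pm a)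

theorem ad_ιU_pow_apply (a : L.grade 0) (m : ℕ) (v : g) :
    (LieAlgebra.ad κ L.UEnv (L.ιU a) ^ m) (L.ιU v) = L.ιU ((L.ad a ^ m) v) := by
  induction m with
  | zero => rfl
  | succ m ih =>
    rw [pow_succ', pow_succ', Module.End.mul_apply, ih, LieAlgebra.ad_apply,
      ← ιU_bracket_even a.2]
    rfl

variable {ι : Type*} {e : Module.Basis ι κ g} {par : ι → ZMod 2}

theorem ιU_mem_degreeLT (v : g) : L.ιU v ∈ degreeLT κ (fun i => L.ιU (e i)) 2 := by
  have hle : ⊤ ≤ (degreeLT κ (fun i => L.ιU (e i)) 2).comap L.ιU := by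
    rw [← e.span_eq, Submodule.span_le]
    rintro _ ⟨i, rfl⟩
    exact (LeadingEq.generator i).2
  exact hle Submodule.mem_top

variable {l : List ι} {c : ι → L.UEnv}

theorem exists_pCentral_basis (h2 : (2 : κ) ≠ 0) (h3 : (3 : κ) ≠ 0)
    (he : ∀ i, e i ∈ L.grade (par i)) (hl : l.Nodup) (hmem : ∀ i, i ∈ l) (hp : 2 ≤ p) {d : ι → g}
    (hc : ∀ i, c i = L.ιU (e i) ^ p - L.ιU (d i)) :
    ∃ B : Module.Basis {F : ι → ℕ // ∀ i, par i = 1 → F i < 2} κ L.UEnv,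
      ∀ F, B F = mixedMonomial p l (fun i => L.ιU (e i)) c F := by
  obtain ⟨B, hB⟩ := exists_pbwBasis h2 h3 he hl hmem
  refine exists_mixedMonomial_basis B hB (prod_mem_span_listMonomial h2 he hl hmem) fun i => ?_
  rw [hc, sub_sub_cancel_left]
  exact neg_mem (degreeLT_mono hp (ιU_mem_degreeLT (d i)))

variable [Fact p.Prime] [CharP κ p]

theorem pCentral_commute (hpm : L.IsPMap p pm) (a : L.grade 0) (u : L.UEnv) :
    Commute (pCentral p pm a) u := by
  have hι (v : g) : Commute (pCentral p pm a) (L.ιU v) := by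
    have := ad_ιU_pow_apply a p v
    rw [ad_pow_char, ← hpm.ad_pow, ιU_bracket_even (pm a).2, LieAlgebra.ad_apply] at this
    rw [Commute, SemiconjBy, pCentral, sub_mul, mul_sub, sub_eq_sub_iff_sub_eq_sub]
    exact this
  obtain ⟨t, rfl⟩ := RingQuot.mkAlgHom_surjective κ _ u
  induction t using TensorAlgebra.induction with
  | algebraMap c =>
    rw [AlgHom.commutes]
    exact (Algebra.commutes c _).symm
  | ι v => exact hι v
  | mul s t hs ht =>
    rw [map_mul]
    exact hs.mul_right ht
  | add s t hs ht =>
    rw [map_add]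
    exact hs.add_right ht

/-- `a ↦ a ^ p - a^[p]` as a `p`-semilinear map from the even part to the enveloping algebra. -/
noncomputable def pCentralHom (hpm : L.IsPMap p pm) : L.grade 0 →ₛₗ[frobenius κ p] L.UEnv where
  toFun := pCentral p pm
  map_add' a b := by
    rw [pCentral, hpm.add, Submodule.coe_add, map_add, add_pow_char_eq_jacobsonTerm p L.ιU
      (ιU_bracket_even a.2) (ιU_bracket_even b.2), map_add, map_add, pCentral, pCentral]
    abel
  map_smul' c a := by
    rw [pCentral, hpm.smul, Submodule.coe_smul, Submodule.coe_smul, map_smul, map_smul, smul_pow,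
      pCentral, smul_sub, frobenius_def]

theorem pCentral_mem_of_basis (hpm : L.IsPMap p pm) (he : ∀ i, e i ∈ L.grade (par i))
    {N : Submodule κ L.UEnv}
    (hN : ∀ i (hi : par i = 0), pCentral p pm ⟨e i, hi ▸ he i⟩ ∈ N) (a : L.grade 0) :
    pCentral p pm a ∈ N := by
  have hle : L.grade 0 ≤ (N.comap (pCentralHom hpm)).map (L.grade 0).subtype := by
    refine (span_image_eq_grade he 0).ge.trans (Submodule.span_le.2 ?_)
    rintro _ ⟨i, hi, rfl⟩
    exact ⟨_, hN i hi, rfl⟩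
  obtain ⟨b, hb, hba⟩ := hle a.2
  rwa [← (Subtype.ext hba : b = a)]

section Kernel

variable (hpm : L.IsPMap p pm) (he : ∀ i, e i ∈ L.grade (par i)) (hl : l.Nodup)
  (hmem : ∀ i, i ∈ l) (hc : ∀ i (hi : par i = 0), c i = pCentral p pm ⟨e i, hi ▸ he i⟩)
  {B : Module.Basis {F : ι → ℕ // ∀ i, par i = 1 → F i < 2} κ L.UEnv}
  (hB : ∀ F, B F = mixedMonomial p l (fun i => L.ιU (e i)) c F)
include hpm hl hmem hc hB

theorem basis_eq_pCentral_mul {i : ι} (hi : par i = 0)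
    {F G : {F : ι → ℕ // ∀ i, par i = 1 → F i < 2}} (hGF : ∀ j, j ≠ i → G.1 j = F.1 j)
    (hGFi : G.1 i = F.1 i + p) : B G = pCentral p pm ⟨e i, hi ▸ he i⟩ * B F := by
  classical
  have hG : G.1 = F.1 + Pi.single i p := by
    funext j
    rw [Pi.add_apply]
    by_cases hj : j = i
    · rw [hj, hGFi, Pi.single_eq_same]
    · rw [hGF j hj, Pi.single_eq_of_ne hj, add_zero]
  rw [hB, hB, hG, mixedMonomial_add_single (Nat.Prime.pos Fact.out) hl (hmem i)
    (hc i hi ▸ pCentral_commute hpm _), hc i hi]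

theorem pCentral_mul_mem_span (a : L.grade 0) (w : L.UEnv) :
    pCentral p pm a * w ∈ Submodule.span κ (B '' {F | ∀ i, par i = 0 → F.1 i < p}ᶜ) := by
  classical
  set J := Submodule.span κ (B '' {F | ∀ i, par i = 0 → F.1 i < p}ᶜ)
  suffices ∀ i (hi : par i = 0), pCentral p pm ⟨e i, hi ▸ he i⟩ * w ∈ J from
    pCentral_mem_of_basis hpm he (N := J.comap (LinearMap.mulRight κ w)) this a
  intro i hi
  suffices ⊤ ≤ J.comap (LinearMap.mulLeft κ (pCentral p pm ⟨e i, hi ▸ he i⟩)) from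
    this Submodule.mem_top
  refine B.span_eq.ge.trans (Submodule.span_le.2 ?_)
  rintro _ ⟨F, rfl⟩
  let G : {F : ι → ℕ // ∀ i, par i = 1 → F i < 2} :=
    ⟨Function.update F.1 i (F.1 i + p), fun j hj => by
      rw [Function.update_of_ne (by rintro rfl; exact zero_ne_one (hi.symm.trans hj))]
      exact F.2 j hj⟩
  have hG : B G = pCentral p pm ⟨e i, hi ▸ he i⟩ * B F :=
    basis_eq_pCentral_mul hpm he hl hmem hc hB hi (fun j hj => Function.update_of_ne hj _ _)
      (Function.update_self i _ F.1)
  refine Submodule.subset_span ⟨G, fun h => (h i hi).not_ge ?_, hG⟩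
  exact (Nat.le_add_left p _).trans (Function.update_self i (F.1 i + p) F.1).ge

theorem mkAlgHom_RRel_basis_eq_zero {F : {F : ι → ℕ // ∀ i, par i = 1 → F i < 2}} {i : ι}
    (hi : par i = 0) (hF : p ≤ F.1 i) : RingQuot.mkAlgHom κ (L.RRel p pm) (B F) = 0 := by
  classical
  let G : {F : ι → ℕ // ∀ i, par i = 1 → F i < 2} :=
    ⟨Function.update F.1 i (F.1 i - p), fun j hj => by
      rw [Function.update_of_ne (by rintro rfl; exact zero_ne_one (hi.symm.trans hj))]
      exact F.2 j hj⟩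
  have hFG : B F = pCentral p pm ⟨e i, hi ▸ he i⟩ * B G :=
    basis_eq_pCentral_mul hpm he hl hmem hc hB hi
      (fun j hj => (Function.update_of_ne hj _ _).symm)
      ((Nat.sub_add_cancel hF).symm.trans
        (congrArg (· + p) (Function.update_self i (F.1 i - p) F.1).symm))
  rw [hFG, map_mul, pCentral, map_sub, RingQuot.mkAlgHom_rel κ (RRel.mk _), sub_self, zero_mul]

theorem ker_mkAlgHom_RRel :
    LinearMap.ker (RingQuot.mkAlgHom κ (L.RRel p pm)).toLinearMap =
      Submodule.span κ (B '' {F | ∀ i, par i = 0 → F.1 i < p}ᶜ) := by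
  apply le_antisymm
  · rw [ker_ringQuot_mkAlgHom, Submodule.mul_le]
    intro m hm v _
    refine Submodule.mul_induction_on hm (fun u _ t ht => mul_mul_mem_of_mem_span ht ?_)
      fun m m' h h' => by rw [add_mul]; exact add_mem h h'
    rintro _ ⟨_, _, ⟨a⟩, rfl⟩
    change u * pCentral p pm a * v ∈ _
    rw [← (pCentral_commute hpm a u).eq, mul_assoc]
    exact pCentral_mul_mem_span hpm he hl hmem hc hB a _
  · rw [Submodule.span_le]
    rintro _ ⟨F, hF, rfl⟩
    obtain ⟨i, hi, hFi⟩ : ∃ i, par i = 0 ∧ p ≤ F.1 i := by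
      simpa only [Set.mem_compl_iff, Set.mem_ofPred_eq, not_forall, not_lt, exists_prop] using hF
    exact mkAlgHom_RRel_basis_eq_zero hpm he hl hmem hc hB hi hFi

end Kernel

theorem exists_restrictedPBWBasis (h2 : (2 : κ) ≠ 0) (h3 : (3 : κ) ≠ 0) (hpm : L.IsPMap p pm)
    (he : ∀ i, e i ∈ L.grade (par i)) (hl : l.Nodup) (hmem : ∀ i, i ∈ l) :
    ∃ B : Module.Basis {F : ι → ℕ // (∀ i, par i = 1 → F i < 2) ∧ ∀ i, par i = 0 → F i < p}
        κ (L.REnv p pm),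
      ∀ F, B F = listMonomial l (fun i => L.ιR p pm (e i)) F := by
  classical
  have hp : 2 ≤ p := Nat.Prime.two_le Fact.out
  let d i : g := if hi : par i = 0 then pm ⟨e i, hi ▸ he i⟩ else 0
  obtain ⟨B, hB⟩ := exists_pCentral_basis h2 h3 he hl hmem hp (d := d) fun _ => rfl
  have hker := ker_mkAlgHom_RRel hpm he hl hmem
    (fun i hi => by rw [pCentral, show d i = pm ⟨e i, hi ▸ he i⟩ from dif_pos hi]) hB
  obtain ⟨B', hB'⟩ := exists_basis_of_ker_eq_span_image_compl (N := L.REnv p pm) B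
    (RingQuot.mkAlgHom_surjective κ _) hker
  refine ⟨B'.reindex (Equiv.subtypeSubtypeEquivSubtypeInter
    (fun F : ι → ℕ => ∀ i, par i = 1 → F i < 2) fun F => ∀ i, par i = 0 → F i < p), fun F => ?_⟩
  have hF (i : ι) : F.1 i < p := by
    rcases parity_cases (par i) with hi | hi
    · exact F.2.2 i hi
    · exact (F.2.1 i hi).trans_le hp
  rw [Module.Basis.reindex_apply, hB', hB]
  refine (congrArg _ (mixedMonomial_of_lt l _ _ hF)).trans ?_
  simp only [listMonomial, AlgHom.toLinearMap_apply, map_list_prod, List.map_map,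
    Function.comp_def, map_pow]
  rfl

end RestrictedPBWBasis

end LieSuperalgebra

theorem exists_basis_sup_of_disjoint {R M ι τ : Type*} [Ring R] [AddCommGroup M] [Module R M]
    {N₁ N₂ N : Submodule R M} (b₁ : Module.Basis ι R N₁) (b₂ : Module.Basis τ R N₂)
    (hd : Disjoint N₁ N₂) (hN : N₁ ⊔ N₂ = N) :
    ∃ b : Module.Basis (ι ⊕ τ) R N,
      (∀ i, (b (Sum.inl i) : M) = b₁ i) ∧ ∀ k, (b (Sum.inr k) : M) = b₂ k := by
  have hinj : Function.Injective (N₁.subtype.coprod N₂.subtype) := by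
    rw [← LinearMap.ker_eq_bot, LinearMap.ker_coprod_of_disjoint_range _ _ (by simpa using hd)]
    simp
  have hrange : LinearMap.range (N₁.subtype.coprod N₂.subtype) = N := by
    rw [LinearMap.range_coprod, N₁.range_subtype, N₂.range_subtype, hN]
  refine ⟨(b₁.prod b₂).map ((LinearEquiv.ofInjective _ hinj).trans (LinearEquiv.ofEq _ N hrange)),
    fun i => ?_, fun k => ?_⟩ <;> simp

/-- Letters for a basis adapted to the squares of the odd elements: `inl j` stands for the odd
basis vector `x j`, `inr (inl j)` for `[x j, x j] / 2`, which is the square of `x j` in the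
enveloping algebra, and `inr (inr k)` for the remaining even basis vector `y k`. -/
abbrev Letter {ι : Type*} (P : ι → Prop) (τ : Type*) : Type _ := ι ⊕ {j // P j} ⊕ τ

namespace Letter

variable {ι τ : Type*} {P : ι → Prop}

/-- The degree in `ℤ/2` of the basis vector that a letter stands for. -/
def parity : Letter P τ → ZMod 2 := Sum.elim (fun _ => 1) fun _ => 0

variable [DecidablePred P]

/-- The letter for `x j`, followed by the one for its square if there is one. -/
def block (j : ι) : List (Letter P τ) :=
  if h : P j then [Sum.inl j, Sum.inr (Sum.inl ⟨j, h⟩)] else [Sum.inl j]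

/-- The letters for `j` in `l` and `k` in `m`, each square following its root, so that their powers
can be merged. -/
def list (l : List ι) (m : List τ) : List (Letter P τ) :=
  l.flatMap block ++ m.map fun k => Sum.inr (Sum.inr k)

theorem mem_block {a : Letter P τ} {j : ι} :
    a ∈ block j ↔ a = Sum.inl j ∨ ∃ h, a = Sum.inr (Sum.inl ⟨j, h⟩) := by
  unfold block
  split_ifs with h <;> simp [h]

theorem nodup_block (j : ι) : (block j : List (Letter P τ)).Nodup := by
  unfold block
  split_ifs <;> simp

theorem nodup_list {l : List ι} {m : List τ} (hl : l.Nodup) (hm : m.Nodup) :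
    (list l m : List (Letter P τ)).Nodup := by
  refine List.nodup_append'.2 ⟨List.nodup_flatMap.2 ⟨fun j _ => nodup_block j, ?_⟩,
    hm.map (Sum.inr_injective.comp Sum.inr_injective), ?_⟩
  · refine hl.imp fun {i j} hij a hi hj => hij ?_
    rcases mem_block.1 hi with rfl | ⟨_, rfl⟩
    · simpa [mem_block] using hj
    · obtain ⟨_, h⟩ := (mem_block.1 hj).resolve_left Sum.inr_ne_inl
      simpa using h
  · intro a ha ha'
    obtain ⟨k, -, rfl⟩ := List.mem_map.1 ha'
    simp [mem_block] at ha

theorem mem_list {l : List ι} {m : List τ} (hl : ∀ j, j ∈ l) (hm : ∀ k, k ∈ m)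
    (a : Letter P τ) : a ∈ list l m := by
  rcases a with j | j | k <;> simp [list, mem_block, hl, hm]

/-- An exponent `b` of `x j` corresponds to the exponents `b % 2` of `x j` and `b / 2` of its
square. -/
def expEquiv (Q : ℕ → Prop) :
    {E : (ι → ℕ) × (τ → ℕ) // (∀ j, ¬P j → E.1 j < 2) ∧ (∀ j, P j → Q (E.1 j / 2)) ∧
      ∀ k, Q (E.2 k)} ≃
    {F : Letter P τ → ℕ // (∀ a, parity a = 1 → F a < 2) ∧ ∀ a, parity a = 0 → Q (F a)} where
  toFun E := ⟨Sum.elim (fun j => E.1.1 j % 2) (Sum.elim (fun j => E.1.1 j / 2) E.1.2), by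
    refine ⟨?_, ?_⟩
    · rintro (j | _) h
      · exact Nat.mod_lt _ two_pos
      · exact absurd h zero_ne_one
    · rintro (_ | j | k) h
      · exact absurd h one_ne_zero
      · exact E.2.2.1 j.1 j.2
      · exact E.2.2.2 k⟩
  invFun F := ⟨(fun j => F.1 (Sum.inl j) +
      if h : P j then 2 * F.1 (Sum.inr (Sum.inl ⟨j, h⟩)) else 0,
      fun k => F.1 (Sum.inr (Sum.inr k))), by
    have hF (j : ι) : F.1 (Sum.inl j) < 2 := F.2.1 _ rfl
    refine ⟨fun j hj => ?_, fun j hj => ?_, fun k => F.2.2 _ rfl⟩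
    · simpa only [dif_neg hj, add_zero] using hF j
    · simpa only [dif_pos hj, Nat.add_mul_div_left _ _ two_pos, Nat.div_eq_of_lt (hF j), zero_add]
        using F.2.2 (Sum.inr (Sum.inl ⟨j, hj⟩)) rfl⟩
  left_inv E := by
    ext j
    · by_cases h : P j
      · simp [h, Nat.mod_add_div]
      · simpa [h] using E.2.1 j h
    · rfl
  right_inv F := by
    have hF (j : ι) : F.1 (Sum.inl j) < 2 := F.2.1 _ rfl
    ext (j | j | k)
    · by_cases h : P j <;> simp [h, Nat.mod_eq_of_lt (hF j)]
    · simp [j.2, Nat.add_mul_div_left _ _ two_pos, Nat.div_eq_of_lt (hF j.1)]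
    · rfl

theorem prod_map_block {A : Type*} [Monoid A] (f : Letter P τ → A) (j : ι) :
    ((block j).map f).prod =
      f (Sum.inl j) * if h : P j then f (Sum.inr (Sum.inl ⟨j, h⟩)) else 1 := by
  unfold block
  split_ifs <;> simp

theorem listMonomial_list {A : Type*} [Monoid A] {f : Letter P τ → A}
    (hf : ∀ j, f (Sum.inr (Sum.inl j)) = f (Sum.inl j.1) ^ 2) (l : List ι) (m : List τ)
    (Q : ℕ → Prop) (E) :
    listMonomial (list l m) f (expEquiv Q E).1 =
      listMonomial l (fun j => f (Sum.inl j)) E.1.1 *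
        listMonomial m (fun k => f (Sum.inr (Sum.inr k))) E.1.2 := by
  have hblock (j : ι) : ((block j).map fun a => f a ^ (expEquiv Q E).1 a).prod =
      f (Sum.inl j) ^ E.1.1 j := by
    rw [prod_map_block]
    change f (Sum.inl j) ^ (E.1.1 j % 2) *
      (if h : P j then f (Sum.inr (Sum.inl ⟨j, h⟩)) ^ (E.1.1 j / 2) else 1) = _
    split_ifs with h
    · rw [hf, ← pow_mul, ← pow_add, Nat.mod_add_div]
    · rw [Nat.mod_eq_of_lt (E.2.1 j h), mul_one]
  simp only [listMonomial, list, List.map_append, List.prod_append, List.map_flatMap,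
    List.flatMap_def (f := fun _ => List.map _ _), List.prod_flatten, List.map_map,
    Function.comp_def, hblock]
  rfl

theorem exists_basis {κ A : Type*} [Semiring κ] [Semiring A] [Module κ A] {f : Letter P τ → A}
    (hf : ∀ j, f (Sum.inr (Sum.inl j)) = f (Sum.inl j.1) ^ 2) {l : List ι} {m : List τ}
    {Q : ℕ → Prop}
    (B : Module.Basis {F : Letter P τ → ℕ // (∀ a, parity a = 1 → F a < 2) ∧
      ∀ a, parity a = 0 → Q (F a)} κ A) (hB : ∀ F, B F = listMonomial (list l m) f F) :
    ∃ B' : Module.Basis {E : (ι → ℕ) × (τ → ℕ) // (∀ j, ¬P j → E.1 j < 2) ∧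
        (∀ j, P j → Q (E.1 j / 2)) ∧ ∀ k, Q (E.2 k)} κ A,
      ∀ E, B' E = listMonomial l (fun j => f (Sum.inl j)) E.1.1 *
        listMonomial m (fun k => f (Sum.inr (Sum.inr k))) E.1.2 :=
  ⟨B.reindex (expEquiv Q).symm, fun E => by
    rw [Module.Basis.reindex_apply, hB, Equiv.symm_symm, listMonomial_list hf]⟩

end Letter

namespace LieSuperalgebra

variable {κ g : Type*} [Field κ] [AddCommGroup g] [Module κ g] {L : LieSuperalgebra κ g}

theorem ιU_half_bracket_self (h2 : (2 : κ) ≠ 0) {a : g} (ha : a ∈ L.grade 1) :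
    L.ιU ((2⁻¹ : κ) • L.bracket a a) = L.ιU a ^ 2 := by
  have h := ιU_mul_ιU ha ha
  rw [koszulSign_one_one] at h
  replace h := h.trans (congrArg _ (neg_one_smul κ (L.ιU a * L.ιU a)))
  rw [← sub_eq_add_neg, eq_sub_iff_add_eq, ← two_smul κ] at h
  rw [map_smul, ← h, inv_smul_smul₀ h2, sq]

theorem isCompl_grade_one_grade_zero : IsCompl (L.grade 1) (L.grade 0) :=
  L.isInternal.isCompl one_ne_zero
    (Set.eq_univ_of_forall fun i => (parity_cases i).symm).symm

theorem exists_letterBasis (h2 : (2 : κ) ≠ 0) {ι τ : Type*} {P : ι → Prop}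
    (x : Module.Basis ι κ (L.grade 1))
    (hz : LinearIndependent κ fun j : {j // P j} => L.bracket (x j.1 : g) (x j.1 : g))
    {V W : Submodule κ g}
    (hV : V = Submodule.span κ (Set.range
      fun j : {j // P j} => L.bracket (x j.1 : g) (x j.1 : g)))
    (hWV : Disjoint W V) (hWV' : W ⊔ V = L.grade 0) (y : Module.Basis τ κ W) :
    ∃ b : Module.Basis (Letter P τ) κ g,
      (∀ j, b (Sum.inl j) = x j) ∧
      (∀ j, b (Sum.inr (Sum.inl j)) = (2⁻¹ : κ) • L.bracket (x j.1 : g) (x j.1 : g)) ∧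
      ∀ k, b (Sum.inr (Sum.inr k)) = y k := by
  subst hV
  let z := (Module.Basis.span hz).isUnitSMul fun _ => (inv_ne_zero h2).isUnit
  obtain ⟨b₀, hz₀, hy₀⟩ := exists_basis_sup_of_disjoint z y hWV.symm (sup_comm _ W ▸ hWV')
  obtain ⟨b, hx, hb⟩ := exists_basis_sup_of_disjoint x b₀
    isCompl_grade_one_grade_zero.disjoint isCompl_grade_one_grade_zero.sup_eq_top
  refine ⟨b.map Submodule.topEquiv, hx, fun j => ?_, fun k => (hb _).trans (hy₀ k)⟩
  refine (hb _).trans ((hz₀ j).trans ?_)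
  rw [Module.Basis.isUnitSMul_apply, Submodule.coe_smul, Module.Basis.span_apply]

theorem mem_grade_parity {ι τ : Type*} {P : ι → Prop} {x : ι → L.grade 1} {y : τ → g}
    (hy : ∀ k, y k ∈ L.grade 0) {b : Letter P τ → g} (hbx : ∀ j, b (Sum.inl j) = x j)
    (hbz : ∀ j, b (Sum.inr (Sum.inl j)) = (2⁻¹ : κ) • L.bracket (x j.1 : g) (x j.1 : g))
    (hby : ∀ k, b (Sum.inr (Sum.inr k)) = y k) (a : Letter P τ) :
    b a ∈ L.grade (Letter.parity a) := by
  rcases a with j | j | k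
  · exact hbx j ▸ (x j).2
  · exact hbz j ▸ Submodule.smul_mem _ _ (L.bracket_mem 1 1 _ _ (x j.1).2 (x j.1).2)
  · exact hby k ▸ hy k

end LieSuperalgebra

theorem proposition2p5_general {κ : Type*} {g : Type*} [Field κ] (h2 : (2 : κ) ≠ 0)
    (h3 : (3 : κ) ≠ 0) [AddCommGroup g] [Module κ g] (L : LieSuperalgebra κ g) (s s₁ t₁ : ℕ)
    (x : Module.Basis (Fin s) κ (L.grade 1))
    (hz : LinearIndependent κ
      (fun j : {j : Fin s // s₁ ≤ (j : ℕ)} => L.bracket (x j.1 : g) (x j.1 : g)))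
    (V : Submodule κ g)
    (hV : V = Submodule.span κ
      (Set.range fun j : {j : Fin s // s₁ ≤ (j : ℕ)} => L.bracket (x j.1 : g) (x j.1 : g)))
    (W : Submodule κ g) (hWV : Disjoint W V) (hWV' : W ⊔ V = L.grade 0)
    (y : Module.Basis (Fin t₁) κ W) :
    (∃ B : Module.Basis
        {e : (Fin s → ℕ) × (Fin t₁ → ℕ) // ∀ i : Fin s, (i : ℕ) < s₁ → e.1 i < 2} κ L.UEnv,
      ∀ e, B e = orderedMonomial (fun i => L.ιU (x i : g)) e.1.1 *
        orderedMonomial (fun k => L.ιU (y k : g)) e.1.2) ∧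
    (∀ (p : ℕ) [Fact p.Prime] [CharP κ p] (pm : L.grade 0 → L.grade 0), L.IsPMap p pm →
      ∃ B : Module.Basis
        {e : (Fin s → ℕ) × (Fin t₁ → ℕ) // (∀ i : Fin s, (i : ℕ) < s₁ → e.1 i < 2) ∧
          (∀ j : Fin s, s₁ ≤ (j : ℕ) → e.1 j < 2 * p) ∧ (∀ k : Fin t₁, e.2 k < p)}
        κ (L.REnv p pm),
      ∀ e, B e = orderedMonomial (fun i => L.ιR p pm (x i : g)) e.1.1 *
        orderedMonomial (fun k => L.ιR p pm (y k : g)) e.1.2) := by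
  obtain ⟨b, hbx, hbz, hby⟩ := LieSuperalgebra.exists_letterBasis h2 x hz hV hWV hWV' y
  have hpar := LieSuperalgebra.mem_grade_parity
    (fun k => hWV' ▸ Submodule.mem_sup_left (y k).2) hbx hbz hby
  have hsq (j : {j : Fin s // s₁ ≤ (j : ℕ)}) :
      L.ιU (b (Sum.inr (Sum.inl j))) = L.ιU (b (Sum.inl j.1)) ^ 2 := by
    rw [hbz, hbx, LieSuperalgebra.ιU_half_bracket_self h2 (x j.1).2]
  have hnodup := Letter.nodup_list (P := fun j : Fin s => s₁ ≤ (j : ℕ)) (List.nodup_finRange s)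
    (List.nodup_finRange t₁)
  have hmem := Letter.mem_list (P := fun j : Fin s => s₁ ≤ (j : ℕ)) List.mem_finRange
    (List.mem_finRange (n := t₁))
  simp only [orderedMonomial_eq_listMonomial, ← hbx, ← hby]
  refine ⟨?_, fun p _ _ pm hpm => ?_⟩
  · obtain ⟨B, hB⟩ := LieSuperalgebra.exists_pbwBasis h2 h3 hpar hnodup hmem
    obtain ⟨B', hB'⟩ := Letter.exists_basis hsq (Q := fun _ => True)
      (B.reindex (Equiv.subtypeEquivRight fun F => by simp)) fun F => by
        rw [Module.Basis.reindex_apply, hB]; rfl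
    exact ⟨B'.reindex (Equiv.subtypeEquivRight fun E => by simp), fun E => by
      rw [Module.Basis.reindex_apply, hB']; rfl⟩
  · obtain ⟨B, hB⟩ := LieSuperalgebra.exists_restrictedPBWBasis h2 h3 hpm hpar hnodup hmem
    obtain ⟨B', hB'⟩ := Letter.exists_basis (Q := (· < p)) (fun j =>
      (congrArg (RingQuot.mkAlgHom κ (L.RRel p pm)) (hsq j)).trans (map_pow _ _ 2)) B hB
    exact ⟨B'.reindex (Equiv.subtypeEquivRight fun E => by
      simp only [not_le, Nat.div_lt_iff_lt_mul two_pos, mul_comm p 2]), fun E => by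
      rw [Module.Basis.reindex_apply, hB']; rfl⟩

theorem proposition2p5 {κ : Type*} {g : Type*} [Field κ] [IsAlgClosed κ]
    (p : ℕ) [CharP κ p] (hp : 3 < p) [AddCommGroup g] [Module κ g]
    (L : LieSuperalgebra κ g) (s s₁ t₁ : ℕ) (hs : s₁ ≤ s)
    (x : Module.Basis (Fin s) κ (L.grade 1))
    (hx₀ : ∀ i : Fin s, (i : ℕ) < s₁ → L.bracket (x i : g) (x i : g) = 0)
    (hx₁ : ∀ j : Fin s, s₁ ≤ (j : ℕ) → L.bracket (x j : g) (x j : g) ≠ 0)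
    (hz : LinearIndependent κ
      (fun j : {j : Fin s // s₁ ≤ (j : ℕ)} => L.bracket (x j.1 : g) (x j.1 : g)))
    (V : Submodule κ g)
    (hV : V = Submodule.span κ
      (Set.range fun j : {j : Fin s // s₁ ≤ (j : ℕ)} => L.bracket (x j.1 : g) (x j.1 : g)))
    (W : Submodule κ g) (hWV : Disjoint W V) (hWV' : W ⊔ V = L.grade 0)
    (y : Module.Basis (Fin t₁) κ W) :
    (∃ B : Module.Basis
        {e : (Fin s → ℕ) × (Fin t₁ → ℕ) // ∀ i : Fin s, (i : ℕ) < s₁ → e.1 i < 2} κ L.UEnv,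
      ∀ e, B e = orderedMonomial (fun i => L.ιU (x i : g)) e.1.1 *
        orderedMonomial (fun k => L.ιU (y k : g)) e.1.2) ∧
    (∀ pm : L.grade 0 → L.grade 0, L.IsPMap p pm →
      ∃ B : Module.Basis
        {e : (Fin s → ℕ) × (Fin t₁ → ℕ) // (∀ i : Fin s, (i : ℕ) < s₁ → e.1 i < 2) ∧
          (∀ j : Fin s, s₁ ≤ (j : ℕ) → e.1 j < 2 * p) ∧ (∀ k : Fin t₁, e.2 k < p)}
        κ (L.REnv p pm),
      ∀ e, B e = orderedMonomial (fun i => L.ιR p pm (x i : g)) e.1.1 *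
        orderedMonomial (fun k => L.ιR p pm (y k : g)) e.1.2) := by
  have hprime : Fact p.Prime := ⟨(CharP.char_is_prime_or_zero κ p).resolve_right (by omega)⟩
  have hne (m : ℕ) (h0 : 0 < m) (hm : m < p) : (m : κ) ≠ 0 := fun h =>
    Nat.not_dvd_of_pos_of_lt h0 hm ((CharP.cast_eq_zero_iff κ p m).1 h)
  exact (proposition2p5_general (hne 2 two_pos (by omega)) (hne 3 three_pos hp) L s s₁ t₁ x hz V hV
    W hWV hWV' y).imp_right fun h => h p
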